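/- Let $(\varepsilon_n)_{n\ge 1}$ be a Rademacher sequence on a probability space, i.e. independent random variables with $P(\varepsilon_n=1)=P(\varepsilon_n=-1)=\tfrac12$. For a scalar sequence $a=(a_n)\in\ell_2$ and $t>0$ put $$K_{1,2}(a,t)=\inf\{\|b\|_{1}+t\|c\|_{2} : a=b+c,\ b\in\ell_1,\ c\in\ell_2\},$$ and for a sequence $(x_n)$ in a (real or complex) Banach space $E$ such that $(x^*(x_n))\in\ell_2$ for every $x^*\in E^*$ (that is, a weakly-$\ell_2$ sequence) put $$K^w_{1,2}((x_n),t)=\sup_{x^*\in E^*,\ \|x^*\|\le 1}K_{1,2}((x^*(x_n)),t).$$ There is an absolute constant $C>0$ (depending neither on $p$, nor on $E$, nor on $(x_n)$) with the following property. Let $X=\sum_n\varepsilon_n x_n$ be an almost surely convergent Rademacher series in a Banach space $E$. Then $(x_n)$ is weakly-$\ell_2$, and for every real $p$ with $1\le p<\infty$ the quantities $\mathbb E\|X\|^p$ and $K^w_{1,2}((x_n),\sqrt p)$ are finite and $$\frac1C\,(\mathbb E\|X\|^p)^{1/p}\le \mathbb E\|X\|+K^w_{1,2}((x_n),\sqrt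 p)\le C\,(\mathbb E\|X\|^p)^{1/p}.$$ -/

import Mathlib

open MeasureTheory ProbabilityTheory Filter Topology

/-- A Rademacher sequence on the probability space `(Ω, P)`: independent random variables, each
taking the values `1` and `-1` with probability `1 / 2`. -/
structure IsRademacherSequence {Ω : Type*} [MeasurableSpace Ω] (P : Measure Ω)
    (ε : ℕ → Ω → ℝ) : Prop where
  measurable : ∀ n, Measurable (ε n)
  indep : iIndepFun ε P
  prob_one : ∀ n, P {ω | ε n ω = 1} = 1 / 2
  prob_neg_one : ∀ n, P {ω | ε n ω = -1} = 1 / 2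

/-- The K-functional `K_{1,2}(a, t) = K(a, t; ℓ₁, ℓ₂)` of a scalar sequence `a`: the infimum of
`‖b‖₁ + t ‖c‖₂` over all decompositions `a = b + c` with `b ∈ ℓ₁` and `c ∈ ℓ₂`.
It is used for `a ∈ ℓ₂` (which is the same as `a ∈ ℓ₁ + ℓ₂`). -/
noncomputable def kFunctional {𝕜 : Type*} [RCLike 𝕜] (a : ℕ → 𝕜) (t : ℝ) : ℝ :=
  sInf {r : ℝ | ∃ (b : lp (fun _ : ℕ => 𝕜) 1) (c : lp (fun _ : ℕ => 𝕜) 2),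
    (∀ n, a n = b n + c n) ∧ r = ‖b‖ + t * ‖c‖}

/-- The sequence `x` in `E` is weakly-`ℓ₂`: `(φ (x n))` belongs to `ℓ₂` for every continuous linear
functional `φ`. -/
def IsWeaklyEllTwo (𝕜 : Type*) [RCLike 𝕜] {E : Type*} [NormedAddCommGroup E] [NormedSpace 𝕜 E]
    (x : ℕ → E) : Prop :=
  ∀ φ : E →L[𝕜] 𝕜, Memℓp (fun n => φ (x n)) 2

/-- The set of the numbers `K_{1,2}((φ (x n)), t)`, where `φ` runs over the closed unit ball of the
dual space of `E`. -/
def weakKValues (𝕜 : Type*) [RCLike 𝕜] {E : Type*} [NormedAddCommGroup E] [NormedSpace 𝕜 E]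
    (x : ℕ → E) (t : ℝ) : Set ℝ :=
  {r : ℝ | ∃ φ : E →L[𝕜] 𝕜, ‖φ‖ ≤ 1 ∧ r = kFunctional (fun n => φ (x n)) t}

/-- `K^w_{1,2}(x, t)`, the supremum of `K_{1,2}((φ (x n)), t)` over all functionals `φ` of norm at
most one. It is used for weakly-`ℓ₂` sequences `x`. -/
noncomputable def weakKFunctional (𝕜 : Type*) [RCLike 𝕜] {E : Type*} [NormedAddCommGroup E]
    [NormedSpace 𝕜 E] (x : ℕ → E) (t : ℝ) : ℝ :=
  sSup (weakKValues 𝕜 x t)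

/-! Everything is proved by counting sign vectors in `{-1, 1}^N`, with constants independent of `N`,
and then passed to the almost sure limit.

The bound on `K^w` is scalar. A sum with coefficients `a` exceeds a fixed multiple of `K(a, √m)`
with probability at least `exp (-8 * m) / 8` (`exists_decomposition_tail`). To see this, split off
at most `m` dominant coefficients as `b` and let `c` be the rest. If `‖b‖₁` dominates `√m ‖c‖₂`, at
most `m` signs have to be aligned. Otherwise `c` is flat, and the Paley-Zygmund argument applied to
an exponential of the sum gives the tail (`card_sqrt_le_sum_of_flat`). With `m = ⌈p⌉`, Markov's
inequality loses only a constant after the `p`-th root (`IsRademacherSequence.weakKFunctional_le`).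

The bound on the moments is concentration. If a convex set `C` contains half of the sign vectors,
Talagrand's inequality bounds the mean of `exp (d² / 32)` by `2`, where `d` is the distance to `C`
(`exists_sq_dist_le_sum_exp_mul_signCount_le`). Take for `C` the points of the cube where the sum
has norm at most `M`. Testing with a functional and splitting its coefficients along the
`K`-functional bounds the norm at distance `d` from `C` by `M + (2 + d / √p) K^w`. Its `p`-th power
is absorbed by `exp (d² / 32)` (`sum_norm_rpow_le`). Fatou's lemma and a choice of `M` just above `2
E‖X‖` finish the estimate. -/

/-! ### Lower tails of scalar sign sums -/

/-- The sign `1` or `-1` encoded by a Boolean. -/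
def boolSign (b : Bool) : ℝ := if b then 1 else -1

theorem boolSign_not (b : Bool) : boolSign (!b) = -boolSign b := by
  cases b <;> simp [boolSign]

theorem abs_boolSign (b : Bool) : |boolSign b| = 1 := by
  cases b <;> simp [boolSign]

theorem sum_exp_boolSign {ι : Type*} [Fintype ι] [DecidableEq ι] (c : ι → ℝ) (l : ℝ) :
    ∑ s : ι → Bool, Real.exp (l * ∑ i, boolSign (s i) * c i) =
      2 ^ Fintype.card ι * ∏ i, Real.cosh (l * c i) := by
  have h : ∀ s : ι → Bool, Real.exp (l * ∑ i, boolSign (s i) * c i) =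
      ∏ i, Real.exp (l * (boolSign (s i) * c i)) := fun s => by
    rw [Finset.mul_sum, Real.exp_sum]
  simp_rw [h]
  rw [← Fintype.prod_sum (fun i b => Real.exp (l * (boolSign b * c i))), ← Finset.card_univ,
    ← Finset.prod_const, ← Finset.prod_mul_distrib]
  refine Finset.prod_congr rfl fun i _ => ?_
  rw [Real.cosh_eq]
  simp [boolSign]
  ring

/-- Bernoulli's inequality gives `3 ^ q ≤ 1 + 2 * q` for `0 ≤ q ≤ 1`, and `1 + y ^ 2 / 2 ≤ cosh y`.
Being exponential in `y ^ 2`, the bound multiplies well over the coefficients. -/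
theorem three_rpow_le_cosh {y : ℝ} (hy : y ^ 2 ≤ 4) : (3 : ℝ) ^ (y ^ 2 / 4) ≤ Real.cosh y := by
  have h1 := rpow_one_add_le_one_add_mul_self (s := 2) (by norm_num)
    (p := y ^ 2 / 4) (by positivity) (by linarith)
  have h2 : 1 + y ^ 2 / 2 ≤ Real.cosh y := by
    have h3 : |y / 2| ≤ Real.sinh |y / 2| := Real.self_le_sinh_iff.2 (abs_nonneg _)
    have h4 := pow_le_pow_left₀ (abs_nonneg _) h3 2
    rw [← Real.abs_sinh, sq_abs, sq_abs] at h4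
    have h5 := Real.cosh_two_mul (y / 2)
    rw [mul_div_cancel₀ y two_ne_zero, Real.cosh_sq] at h5
    rw [h5]
    linarith
  norm_num at h1
  linarith

/-- A lower bound for the tail of a Rademacher sum whose coefficients are small compared to their
`ℓ₂`-norm: the Paley-Zygmund inequality for the exponential of the sum. -/
theorem card_sqrt_le_sum_of_flat {ι : Type*} [Fintype ι] [DecidableEq ι] (c : ι → ℝ) {m : ℕ}
    (hm : 1 ≤ m) (hV : 0 < ∑ j, c j ^ 2) (hc : ∀ i, m * c i ^ 2 ≤ ∑ j, c j ^ 2) :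
    Real.exp (-8 * m) / 4 * 2 ^ Fintype.card ι ≤
      (Finset.univ.filter fun s : ι → Bool =>
        √(m * ∑ j, c j ^ 2) / 6 ≤ ∑ i, boolSign (s i) * c i).card := by
  set V := ∑ j, c j ^ 2 with hVdef
  have hm' : (1 : ℝ) ≤ m := by exact_mod_cast hm
  -- With this `l`, flatness gives `(l * c i) ^ 2 ≤ 4`, the range of `three_rpow_le_cosh`, and these
  -- squares add up to `4 * m`. The mean of `exp (l * S)` is then at least `3 ^ m`, and that of its
  -- square at most `exp (8 * m)`.
  set l := 2 * √(m / V) with hl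
  have hlpos : 0 < l := by positivity
  have hl2 : l ^ 2 = 4 * m / V := by
    rw [hl, mul_pow, Real.sq_sqrt (by positivity)]; ring
  set S : (ι → Bool) → ℝ := fun s => ∑ i, boolSign (s i) * c i with hS
  set D : ℝ := 2 ^ Fintype.card ι with hD
  have hDpos : 0 < D := by positivity
  have hDcard : D = Fintype.card (ι → Bool) := by simp [hD]
  -- first moment
  have h1 : D * 3 ^ m ≤ ∑ s, Real.exp (l * S s) := by
    rw [hS, sum_exp_boolSign]
    gcongr
    calc (3 : ℝ) ^ m = ∏ i, (3 : ℝ) ^ ((l * c i) ^ 2 / 4) := by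
          rw [← Real.rpow_sum_of_pos (by norm_num)]
          rw [← Finset.sum_div]
          simp_rw [mul_pow]
          rw [← Finset.mul_sum, ← hVdef, hl2, ← Real.rpow_natCast]
          congr 1
          field_simp
      _ ≤ _ := by
          refine Finset.prod_le_prod (fun i _ => by positivity) fun i _ => three_rpow_le_cosh ?_
          rw [mul_pow, hl2, div_mul_eq_mul_div, div_le_iff₀ hV]
          nlinarith [hc i]
  have h2 : ∑ s, Real.exp (l * S s) ^ 2 ≤ D * Real.exp (8 * m) := by
    have : ∀ s, Real.exp (l * S s) ^ 2 = Real.exp (2 * l * S s) := fun s => by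
      rw [← Real.exp_nat_mul]; push_cast; ring_nf
    simp_rw [this, hS]
    rw [sum_exp_boolSign]
    gcongr
    calc ∏ i, Real.cosh (2 * l * c i) ≤ ∏ i, Real.exp ((2 * l * c i) ^ 2 / 2) :=
          Finset.prod_le_prod (fun i _ => (Real.cosh_pos _).le) fun i _ =>
            Real.cosh_le_exp_half_sq _
      _ = Real.exp (8 * m) := by
          rw [← Real.exp_sum, ← Finset.sum_div]
          simp_rw [mul_pow]
          rw [← Finset.mul_sum, ← hVdef, hl2]
          congr 1
          field_simp
          norm_num
  set T := Finset.univ.filter fun s : ι → Bool => √(m * V) / 6 ≤ S s with hT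
  -- Below the threshold `l * S s ≤ m / 3`, so the sign vectors outside `T` carry at most half of
  -- the first moment. Cauchy-Schwarz on `T` then bounds its size from below.
  have h3 : ∀ s, s ∉ T → Real.exp (l * S s) ≤ 3 ^ m / 2 := by
    intro s hs
    have hs' : S s < √(m * V) / 6 := by simpa [hT] using hs
    have h4 : l * S s ≤ m / 3 := by
      have : l * (√(m * V) / 6) = m / 3 := by
        have h5 : √(m / V) * √(m * V) = m := by
          rw [← Real.sqrt_mul (by positivity)]
          rw [show (m : ℝ) / V * (m * V) = m ^ 2 by field_simp]
          exact Real.sqrt_sq (by positivity)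
        rw [hl]
        linear_combination h5 / 3
      rw [← this]
      gcongr
    have h6 : Real.exp (1 / 3) ≤ 3 / 2 := by
      have := Real.one_sub_inv_le_log_of_pos (x := 3 / 2) (by norm_num)
      rw [← Real.le_log_iff_exp_le (by norm_num)]
      norm_num at this ⊢
      linarith
    calc Real.exp (l * S s) ≤ Real.exp (m * (1 / 3)) := by
          apply Real.exp_le_exp.2; linarith
      _ = Real.exp (1 / 3) ^ m := Real.exp_nat_mul _ _
      _ ≤ (3 / 2) ^ m := by gcongr
      _ = 3 ^ m / 2 ^ m := by rw [div_pow]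
      _ ≤ 3 ^ m / 2 := by
          gcongr
          calc (2 : ℝ) = 2 ^ 1 := by norm_num
            _ ≤ 2 ^ m := by gcongr; norm_num
  have h4 : ∑ s, Real.exp (l * S s) ≤ ∑ s ∈ T, Real.exp (l * S s) + D * (3 ^ m / 2) := by
    rw [← Finset.sum_add_sum_compl T]
    gcongr
    calc ∑ s ∈ Tᶜ, Real.exp (l * S s) ≤ ∑ s ∈ Tᶜ, (3 : ℝ) ^ m / 2 :=
          Finset.sum_le_sum fun s hs => h3 s (by simpa using hs)
      _ ≤ ∑ s : ι → Bool, (3 : ℝ) ^ m / 2 :=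
          Finset.sum_le_sum_of_subset_of_nonneg (Finset.subset_univ _)
            (fun _ _ _ => by positivity)
      _ = D * (3 ^ m / 2) := by rw [Finset.sum_const, hDcard]; simp
  have h5 : D * (3 ^ m / 2) ≤ ∑ s ∈ T, Real.exp (l * S s) := by linarith
  have h6 : (D * (3 ^ m / 2)) ^ 2 ≤ T.card * (D * Real.exp (8 * m)) := by
    calc (D * (3 ^ m / 2)) ^ 2 ≤ (∑ s ∈ T, Real.exp (l * S s)) ^ 2 := by gcongr
      _ ≤ T.card * ∑ s ∈ T, Real.exp (l * S s) ^ 2 := sq_sum_le_card_mul_sum_sq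
      _ ≤ T.card * ∑ s, Real.exp (l * S s) ^ 2 := by
          gcongr
          exact Finset.subset_univ _
      _ ≤ _ := by gcongr
  have h7 : (1 : ℝ) ≤ (3 ^ m) ^ 2 := one_le_pow₀ (one_le_pow₀ (by norm_num))
  have h8 : D / 4 ≤ T.card * Real.exp (8 * m) := by
    have : D * (D / 4) ≤ D * (T.card * Real.exp (8 * m)) := by
      nlinarith [mul_le_mul_of_nonneg_left h7 (sq_nonneg D)]
    exact le_of_mul_le_mul_left this hDpos
  rw [show (-8 : ℝ) * m = -(8 * m) by ring, Real.exp_neg]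
  have := Real.exp_pos (8 * m)
  field_simp
  linarith

/-- Dropping some of the coefficients at most doubles the tail of a Rademacher sum. -/
theorem card_le_two_mul_card_of_subset {ι : Type*} [Fintype ι] [DecidableEq ι] (a : ι → ℝ)
    (J : Finset ι) (u : ℝ) :
    (Finset.univ.filter fun s : ι → Bool => u ≤ ∑ i ∈ J, boolSign (s i) * a i).card ≤
      2 * (Finset.univ.filter fun s : ι → Bool => u ≤ ∑ i, boolSign (s i) * a i).card := by
  -- The sum over `J` is the average of the full sums at `s` and at `flip s`, so one of these two is
  -- at least `u`.
  let flip : (ι → Bool) → (ι → Bool) := fun (s : ι → Bool) i => if i ∈ J then s i else !(s i)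
  have hflip : Function.Involutive flip := fun s => by
    funext i
    by_cases hi : i ∈ J <;> simp [flip, hi]
  set T := Finset.univ.filter fun s : ι → Bool => u ≤ ∑ i, boolSign (s i) * a i
  have hsub : (Finset.univ.filter fun s : ι → Bool => u ≤ ∑ i ∈ J, boolSign (s i) * a i) ⊆
      T ∪ T.image flip := by
    intro s hs
    simp only [Finset.mem_filter, Finset.mem_univ, true_and] at hs
    have h1 : ∑ i, boolSign (flip s i) * a i =
        ∑ i ∈ J, boolSign (s i) * a i - ∑ i ∈ Jᶜ, boolSign (s i) * a i := by
      rw [← Finset.sum_add_sum_compl J, sub_eq_add_neg, ← Finset.sum_neg_distrib]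
      congr 1
      · exact Finset.sum_congr rfl fun i hi => by simp [flip, hi]
      · refine Finset.sum_congr rfl fun i hi => ?_
        have : i ∉ J := by simpa using hi
        simp [flip, this, boolSign_not]
    have h2 := (Finset.sum_add_sum_compl J fun i => boolSign (s i) * a i)
    by_cases h : u ≤ ∑ i, boolSign (s i) * a i
    · exact Finset.mem_union_left _ (by simpa [T] using h)
    · refine Finset.mem_union_right _ (Finset.mem_image.2 ⟨flip s, ?_, hflip s⟩)
      simp only [T, Finset.mem_filter, Finset.mem_univ, true_and]
      rw [h1]
      push Not at h
      linarith
  calc _ ≤ (T ∪ T.image flip).card := Finset.card_le_card hsub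
    _ ≤ T.card + (T.image flip).card := Finset.card_union_le _ _
    _ ≤ T.card + T.card := Nat.add_le_add_left Finset.card_image_le _
    _ = 2 * T.card := by ring

theorem card_sum_abs_le_sum {ι : Type*} [Fintype ι] [DecidableEq ι] (a : ι → ℝ) (J : Finset ι) :
    2 ^ Fintype.card ι ≤ 2 ^ J.card *
      (Finset.univ.filter fun s : ι → Bool =>
        ∑ i ∈ J, |a i| ≤ ∑ i ∈ J, boolSign (s i) * a i).card := by
  -- The sign vectors that agree with the signs of `a` on `J` and are free elsewhere.
  let F : Finset (ι → Bool) :=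
    Fintype.piFinset fun i => if i ∈ J then {decide (0 ≤ a i)} else Finset.univ
  have hF : F.card = 2 ^ Jᶜ.card := by
    rw [Fintype.card_piFinset, ← Finset.prod_mul_prod_compl J]
    rw [Finset.prod_congr rfl (g := fun _ => 1) (fun i hi => by simp [hi]),
      Finset.prod_congr (s₁ := Jᶜ) rfl (g := fun _ => 2) (fun i hi => by
        have : i ∉ J := by simpa using hi
        simp [this])]
    simp
  have hsub : F ⊆ Finset.univ.filter fun s : ι → Bool =>
      ∑ i ∈ J, |a i| ≤ ∑ i ∈ J, boolSign (s i) * a i := by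
    intro s hs
    simp only [Finset.mem_filter, Finset.mem_univ, true_and]
    refine Finset.sum_le_sum fun i hi => ?_
    have h := Fintype.mem_piFinset.1 hs i
    simp only [hi, if_true, Finset.mem_singleton] at h
    rw [h]
    by_cases h0 : 0 ≤ a i
    · simp [boolSign, h0, abs_of_nonneg h0]
    · simp [boolSign, h0, abs_of_neg (not_le.1 h0)]
  calc 2 ^ Fintype.card ι = 2 ^ J.card * 2 ^ Jᶜ.card := by
        rw [← pow_add, Finset.card_add_card_compl]
    _ ≤ _ := by rw [← hF]; gcongr

/-- Take `J` maximizing the sum among sets of at most `m` indices. An `i ∉ J` violating the bound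
could be added to `J` or, when `J` is full, exchanged for a smaller element; either would increase
the sum. -/
theorem exists_card_le_forall_mul_le_sum {ι : Type*} [Fintype ι] [DecidableEq ι] {a : ι → ℝ}
    (ha : ∀ i, 0 ≤ a i) (m : ℕ) :
    ∃ J : Finset ι, J.card ≤ m ∧ ∀ i ∉ J, m * a i ≤ ∑ j ∈ J, a j := by
  obtain ⟨J, hJ, hmax⟩ := Finset.exists_max_image
    ((Finset.univ : Finset (Finset ι)).filter fun J => J.card ≤ m) (fun J => ∑ j ∈ J, a j)
    ⟨∅, by simp⟩
  simp only [Finset.mem_filter, Finset.mem_univ, true_and] at hJ hmax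
  refine ⟨J, hJ, fun i hi => ?_⟩
  by_contra! h
  have hsum : 0 ≤ ∑ j ∈ J, a j := Finset.sum_nonneg fun j _ => ha j
  have hai : 0 < a i := by
    rcases (ha i).lt_or_eq with h' | h'
    · exact h'
    · rw [← h'] at h; simp at h; linarith
  rcases hJ.lt_or_eq with hlt | heq
  · have := hmax (insert i J) (by rw [Finset.card_insert_of_notMem hi]; exact hlt)
    rw [Finset.sum_insert hi] at this
    linarith
  · obtain ⟨j, hj, hji⟩ : ∃ j ∈ J, a j < a i := by
      by_contra! h'
      have := Finset.card_nsmul_le_sum J a (a i) h'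
      rw [nsmul_eq_mul, heq] at this
      linarith
    have hi' : i ∉ J.erase j := fun h' => hi (Finset.mem_of_mem_erase h')
    have := hmax (insert i (J.erase j)) (by
      rw [Finset.card_insert_of_notMem hi', Finset.card_erase_of_mem hj]
      have := Finset.card_pos.2 ⟨j, hj⟩
      omega)
    rw [Finset.sum_insert hi'] at this
    have h2 := Finset.add_sum_erase J a hj
    linarith

/-- The lower tail bound for real Rademacher sums in terms of the `K`-functional. -/
theorem exists_decomposition_tail_real {ι : Type*} [Fintype ι] [DecidableEq ι] (a : ι → ℝ) {m : ℕ}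
    (hm : 1 ≤ m) :
    ∃ (b c : ι → ℝ) (u : ℝ), (∀ i, a i = b i + c i) ∧ 0 ≤ u ∧
      ∑ i, |b i| + √m * √(∑ i, c i ^ 2) ≤ 12 * u ∧
      Real.exp (-8 * m) / 8 * 2 ^ Fintype.card ι ≤
        (Finset.univ.filter fun s : ι → Bool => u ≤ ∑ i, boolSign (s i) * a i).card := by
  obtain ⟨J, hJm, hJ⟩ := exists_card_le_forall_mul_le_sum (fun i => abs_nonneg (a i)) m
  have hm' : (1 : ℝ) ≤ m := by exact_mod_cast hm
  let b : ι → ℝ := fun i => if i ∈ J then a i else 0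
  let c : ι → ℝ := fun i => if i ∈ J then 0 else a i
  have hb : ∑ i, |b i| = ∑ i ∈ J, |a i| := by
    rw [← Finset.sum_add_sum_compl J]
    rw [Finset.sum_congr (s₁ := J) rfl (g := fun i => |a i|) (fun i hi => by simp [b, hi]),
      Finset.sum_congr (s₁ := Jᶜ) rfl (g := fun _ => 0) (fun i hi => by
        have : i ∉ J := by simpa using hi
        simp [b, this])]
    simp
  set B := ∑ i ∈ J, |a i| with hB
  have hB0 : 0 ≤ B := Finset.sum_nonneg fun _ _ => abs_nonneg _
  set V := ∑ i, c i ^ 2 with hVdef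
  have hV0 : 0 ≤ V := Finset.sum_nonneg fun _ _ => sq_nonneg _
  have habc : ∀ i, a i = b i + c i := fun i => by by_cases hi : i ∈ J <;> simp [b, c, hi]
  -- If `B` is the larger term, aligned signs on `J` reach the level `B`. Otherwise `(m * |a i|) ^ 2
  -- ≤ B ^ 2 ≤ m * V` off `J`, which is the flatness of `c`; the `12` is twice the `6` in the level
  -- `√(m * V) / 6`.
  by_cases hcase : √(m * V) ≤ B
  · refine ⟨b, c, B, habc, hB0, ?_, ?_⟩
    · rw [hb, ← Real.sqrt_mul (by positivity)]
      linarith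
    · have h1 := card_sum_abs_le_sum a J
      have h2 := card_le_two_mul_card_of_subset a J B
      have h3 : (2 : ℝ) ^ Fintype.card ι ≤ 2 ^ m * (2 *
          (Finset.univ.filter fun s : ι → Bool => B ≤ ∑ i, boolSign (s i) * a i).card) := by
        have : 2 ^ Fintype.card ι ≤ 2 ^ m * (2 *
          (Finset.univ.filter fun s : ι → Bool => B ≤ ∑ i, boolSign (s i) * a i).card) := by
          refine h1.trans ?_
          gcongr
          norm_num
        exact_mod_cast this
      have h4 : Real.exp (-8 * m) * 2 ^ m ≤ 1 := by
        rw [mul_comm (-8 : ℝ), Real.exp_nat_mul, ← mul_pow]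
        refine pow_le_one₀ (by positivity) ?_
        have h5 : Real.exp 8 * Real.exp (-8) = 1 := by rw [← Real.exp_add, add_neg_cancel, Real.exp_zero]
        have := Real.add_one_le_exp (8 : ℝ)
        linarith [mul_le_mul_of_nonneg_right this (Real.exp_pos (-8 : ℝ)).le,
          Real.exp_pos (-8 : ℝ)]
      set c' : ℝ := ((Finset.univ.filter fun s : ι → Bool =>
        B ≤ ∑ i, boolSign (s i) * a i).card : ℝ)
      have hc' : 0 ≤ c' := Nat.cast_nonneg _
      calc Real.exp (-8 * m) / 8 * 2 ^ Fintype.card ι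
          ≤ Real.exp (-8 * m) / 8 * (2 ^ m * (2 * c')) := by gcongr
        _ = (Real.exp (-8 * m) * 2 ^ m) * (c' / 4) := by ring
        _ ≤ 1 * (c' / 4) := mul_le_mul_of_nonneg_right h4 (by linarith)
        _ ≤ c' := by linarith
  · push Not at hcase
    refine ⟨b, c, √(m * V) / 6, habc, by positivity, ?_, ?_⟩
    · rw [hb, ← Real.sqrt_mul (by positivity)]
      linarith
    · have hVpos : 0 < V := by
        rcases hV0.lt_or_eq with h | h
        · exact h
        · rw [← h] at hcase; simp at hcase; linarith
      have hBV : B ^ 2 ≤ m * V := by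
        rw [← Real.sq_sqrt (show 0 ≤ m * V by positivity)]
        gcongr
      have h1 := card_sqrt_le_sum_of_flat c hm hVpos (fun i => by
        by_cases hi : i ∈ J
        · have h0 : c i = 0 := by simp [c, hi]
          rw [h0, zero_pow two_ne_zero, mul_zero]
          exact hV0
        · have h := hJ i hi
          have : (m * |a i|) ^ 2 ≤ B ^ 2 := by gcongr
          rw [mul_pow, sq_abs] at this
          have h2 : (m : ℝ) * (m * a i ^ 2) ≤ m * V := by nlinarith
          simp only [c, if_neg hi]
          exact le_of_mul_le_mul_left h2 (by positivity))
      have h2 : (fun s : ι → Bool => ∑ i, boolSign (s i) * c i) =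
          fun s => ∑ i ∈ Jᶜ, boolSign (s i) * a i := by
        funext s
        rw [← Finset.sum_add_sum_compl J]
        rw [Finset.sum_congr (s₁ := J) rfl (g := fun _ => 0) (fun i hi => by simp [c, hi]),
          Finset.sum_congr (s₁ := Jᶜ) rfl (g := fun i => boolSign (s i) * a i) (fun i hi => by
            have : i ∉ J := by simpa using hi
            simp [c, this])]
        simp
      simp_rw [fun s => congrFun h2 s] at h1
      have h3 := card_le_two_mul_card_of_subset a Jᶜ (√(m * V) / 6)
      have h3' : ((Finset.univ.filter fun s : ι → Bool =>
          √(m * V) / 6 ≤ ∑ i ∈ Jᶜ, boolSign (s i) * a i).card : ℝ) ≤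
          2 * (Finset.univ.filter fun s : ι → Bool =>
            √(m * V) / 6 ≤ ∑ i, boolSign (s i) * a i).card := by exact_mod_cast h3
      linarith

/-- The lower tail bound for Rademacher sums in terms of the `K`-functional. -/
theorem exists_decomposition_tail {ι 𝕜 : Type*} [Fintype ι] [DecidableEq ι] [RCLike 𝕜] (a : ι → 𝕜)
    {m : ℕ} (hm : 1 ≤ m) :
    ∃ (b c : ι → 𝕜) (u : ℝ), (∀ i, a i = b i + c i) ∧ 0 ≤ u ∧
      ∑ i, ‖b i‖ + √m * √(∑ i, ‖c i‖ ^ 2) ≤ 48 * u ∧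
      Real.exp (-8 * m) / 8 * 2 ^ Fintype.card ι ≤
        (Finset.univ.filter fun s : ι → Bool =>
          u ≤ ‖∑ i, (boolSign (s i) : 𝕜) * a i‖).card := by
  obtain ⟨b₁, c₁, u₁, h₁, hu₁, hK₁, ht₁⟩ :=
    exists_decomposition_tail_real (fun i => RCLike.re (a i)) hm
  obtain ⟨b₂, c₂, u₂, h₂, hu₂, hK₂, ht₂⟩ :=
    exists_decomposition_tail_real (fun i => RCLike.im (a i)) hm
  have hn : ∀ x y : ℝ, ‖(x : 𝕜) + (y : 𝕜) * RCLike.I‖ ≤ |x| + |y| := fun x y => by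
    refine (norm_add_le _ _).trans ?_
    rw [norm_mul, RCLike.norm_ofReal, RCLike.norm_ofReal]
    gcongr
    calc |y| * ‖(RCLike.I : 𝕜)‖ ≤ |y| * 1 := by
          gcongr
          -- `RCLike.I` is `0` for real scalars, so both cases are needed.
          rcases RCLike.I_mul_I (K := 𝕜) with h | h
          · simp [h]
          · have := congrArg norm h
            rw [norm_mul, norm_neg, norm_one] at this
            nlinarith [norm_nonneg (RCLike.I : 𝕜)]
      _ = |y| := mul_one _
  -- Recombining the two parts costs a factor `2` in the `ℓ₂`-norm, and `u₁ + u₂ ≤ 2 * max u₁ u₂`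
  -- costs another, whence `48 = 4 * 12`.
  refine ⟨fun i => (b₁ i : 𝕜) + (b₂ i : 𝕜) * RCLike.I, fun i => (c₁ i : 𝕜) + (c₂ i : 𝕜) * RCLike.I,
    max u₁ u₂, fun i => ?_, le_max_of_le_left hu₁, ?_, ?_⟩
  · rw [← RCLike.re_add_im (a i), h₁ i, h₂ i]
    push_cast
    ring
  · have hb : ∑ i, ‖(b₁ i : 𝕜) + (b₂ i : 𝕜) * RCLike.I‖ ≤ ∑ i, |b₁ i| + ∑ i, |b₂ i| := by
      rw [← Finset.sum_add_distrib]
      exact Finset.sum_le_sum fun i _ => hn _ _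
    have hc : ∑ i, ‖(c₁ i : 𝕜) + (c₂ i : 𝕜) * RCLike.I‖ ^ 2 ≤
        2 * ∑ i, c₁ i ^ 2 + 2 * ∑ i, c₂ i ^ 2 := by
      rw [Finset.mul_sum, Finset.mul_sum, ← Finset.sum_add_distrib]
      refine Finset.sum_le_sum fun i _ => ?_
      have := pow_le_pow_left₀ (norm_nonneg _) (hn (c₁ i) (c₂ i)) 2
      nlinarith [sq_abs (c₁ i), sq_abs (c₂ i), sq_nonneg (|c₁ i| - |c₂ i|)]
    have hs₁ := Real.sq_sqrt (Finset.sum_nonneg fun i (_ : i ∈ Finset.univ) => sq_nonneg (c₁ i))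
    have hs₂ := Real.sq_sqrt (Finset.sum_nonneg fun i (_ : i ∈ Finset.univ) => sq_nonneg (c₂ i))
    have hc' : √(∑ i, ‖(c₁ i : 𝕜) + (c₂ i : 𝕜) * RCLike.I‖ ^ 2) ≤
        2 * (√(∑ i, c₁ i ^ 2) + √(∑ i, c₂ i ^ 2)) := by
      refine Real.sqrt_le_iff.2 ⟨by positivity, hc.trans ?_⟩
      have := mul_nonneg (Real.sqrt_nonneg (∑ i, c₁ i ^ 2)) (Real.sqrt_nonneg (∑ i, c₂ i ^ 2))
      nlinarith [Real.sqrt_nonneg (∑ i, c₁ i ^ 2), Real.sqrt_nonneg (∑ i, c₂ i ^ 2)]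
    have hb₁ : 0 ≤ ∑ i, |b₁ i| := Finset.sum_nonneg fun _ _ => abs_nonneg _
    have hb₂ : 0 ≤ ∑ i, |b₂ i| := Finset.sum_nonneg fun _ _ => abs_nonneg _
    have := mul_le_mul_of_nonneg_left hc' (Real.sqrt_nonneg (m : ℝ))
    have := le_max_left u₁ u₂
    have := le_max_right u₁ u₂
    nlinarith
  · have hre : ∀ s : ι → Bool, RCLike.re (∑ i, (boolSign (s i) : 𝕜) * a i) =
        ∑ i, boolSign (s i) * RCLike.re (a i) := fun s => by
      rw [map_sum]; simp
    have him : ∀ s : ι → Bool, RCLike.im (∑ i, (boolSign (s i) : 𝕜) * a i) =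
        ∑ i, boolSign (s i) * RCLike.im (a i) := fun s => by
      rw [map_sum]; simp
    rcases le_total u₁ u₂ with h | h
    · rw [max_eq_right h]
      refine ht₂.trans ?_
      gcongr with s
      rw [← him]
      exact (le_abs_self _).trans (RCLike.abs_im_le_norm _)
    · rw [max_eq_left h]
      refine ht₁.trans ?_
      gcongr with s
      rw [← hre]
      exact (le_abs_self _).trans (RCLike.abs_re_le_norm _)

/-! ### Talagrand's inequality on the discrete cube -/

/-- The one-variable optimization in Talagrand's induction, where `u` is the logarithm of the ratio
of the two section sizes. The exponent is minimal at `l = 1 - 4 * u` as long as this is nonnegative;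
for larger `u` the value `l = 0` suffices. -/
theorem exists_exp_add_sq_le {u : ℝ} (hu : 0 ≤ u) :
    ∃ l : ℝ, 0 ≤ l ∧ l ≤ 1 ∧ Real.exp (l * u + (1 - l) ^ 2 / 8) ≤ 2 - Real.exp (-u) := by
  rcases le_total u (1 / 4) with h | h
  · refine ⟨1 - 4 * u, by linarith, by linarith, ?_⟩
    have h1 : Real.exp (-u) ≤ 1 - u + u ^ 2 / 2 := by
      have h2 := Real.quadratic_le_exp_of_nonneg hu
      have h3 : Real.exp (-u) * Real.exp u = 1 := by rw [← Real.exp_add]; simp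
      have h4 : 0 < 1 + u + u ^ 2 / 2 := by positivity
      have h5 : Real.exp (-u) * (1 + u + u ^ 2 / 2) ≤ 1 :=
        (mul_le_mul_of_nonneg_left h2 (Real.exp_pos _).le).trans_eq h3
      have h6 : 1 ≤ (1 - u + u ^ 2 / 2) * (1 + u + u ^ 2 / 2) := by
        nlinarith [sq_nonneg (u ^ 2)]
      exact le_of_mul_le_mul_right (h5.trans h6) h4
    have h7 : Real.exp (u - 2 * u ^ 2) * (1 - u + 2 * u ^ 2) ≤ 1 := by
      have h3 : Real.exp (u - 2 * u ^ 2) * Real.exp (-(u - 2 * u ^ 2)) = 1 := by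
        rw [← Real.exp_add]; simp
      rw [← h3]
      gcongr
      have := Real.add_one_le_exp (-(u - 2 * u ^ 2))
      linarith
    have h8 : 0 < 1 - u + 2 * u ^ 2 := by nlinarith
    have h9 : 1 ≤ (1 + u - u ^ 2 / 2) * (1 - u + 2 * u ^ 2) := by
      have : 0 ≤ u ^ 3 * (5 / 2 - u) := mul_nonneg (by positivity) (by linarith)
      nlinarith [sq_nonneg u]
    have h10 := le_of_mul_le_mul_right (h7.trans h9) h8
    rw [show (1 - 4 * u) * u + (1 - (1 - 4 * u)) ^ 2 / 8 = u - 2 * u ^ 2 by ring]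
    linarith
  · refine ⟨0, le_rfl, zero_le_one, ?_⟩
    have h1 : Real.exp (-u) ≤ 4 / 5 := by
      have h2 : Real.exp (-u) * Real.exp u = 1 := by rw [← Real.exp_add]; simp
      have h3 := Real.add_one_le_exp u
      nlinarith [Real.exp_pos (-u)]
    have h4 : Real.exp (1 / 8) ≤ 8 / 7 := by
      have h2 : Real.exp (1 / 8) * Real.exp (-(1 / 8)) = 1 := by rw [← Real.exp_add]; simp
      have h3 := Real.add_one_le_exp (-(1 / 8) : ℝ)
      nlinarith [Real.exp_pos (1 / 8)]
    norm_num at h4 ⊢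
    linarith

theorem sum_cons_eq {n : ℕ} {M : Type*} [AddCommMonoid M] (f : (Fin (n + 1) → Bool) → M)
    (b : Bool) :
    ∑ s, f s = ∑ s : Fin n → Bool, f (Fin.cons b s) + ∑ s : Fin n → Bool, f (Fin.cons (!b) s) := by
  rw [← (Fin.consEquiv fun _ => Bool).sum_comp f, Fintype.sum_prod_type]
  cases b <;> simp [Fin.consEquiv, add_comm]

theorem boolSign_comp_cons {n : ℕ} (b : Bool) (s : Fin n → Bool) :
    (fun i => boolSign ((Fin.cons b s : Fin (n + 1) → Bool) i)) =
      (Fin.cons (boolSign b) fun i => boolSign (s i) : Fin (n + 1) → ℝ) := by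
  funext i
  refine Fin.cases ?_ (fun j => ?_) i <;> simp

open Classical in
/-- The number of sign vectors in a subset of `ℝⁿ`. -/
noncomputable def signCount {n : ℕ} (C : Set (Fin n → ℝ)) : ℕ :=
  (Finset.univ.filter fun s : Fin n → Bool => (fun i => boolSign (s i)) ∈ C).card

theorem signCount_eq_add {n : ℕ} (C : Set (Fin (n + 1) → ℝ)) (b : Bool) :
    signCount C = signCount {y | (Fin.cons (boolSign b) y : Fin (n + 1) → ℝ) ∈ C} +
      signCount {y | (Fin.cons (boolSign (!b)) y : Fin (n + 1) → ℝ) ∈ C} := by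
  classical
  simp only [signCount, Finset.card_filter]
  rw [sum_cons_eq _ b]
  simp only [boolSign_comp_cons, Set.mem_ofPred_eq]

theorem convex_cons_preimage {n : ℕ} {C : Set (Fin (n + 1) → ℝ)} (hC : Convex ℝ C) (x : ℝ) :
    Convex ℝ {y : Fin n → ℝ | (Fin.cons x y : Fin (n + 1) → ℝ) ∈ C} := by
  intro y hy z hz a b ha hb hab
  have := hC hy hz ha hb hab
  simp only [Set.mem_ofPred_eq]
  convert this using 1
  funext i
  refine Fin.cases ?_ (fun j => ?_) i
  · simp [← add_mul, hab]
  · simp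

/-- Talagrand's inequality for the Euclidean distance of a sign vector to a convex set. -/
theorem exists_sq_dist_le_sum_exp_mul_signCount_le {n : ℕ} {C : Set (Fin n → ℝ)}
    (hC : Convex ℝ C) (hpos : 0 < signCount C) :
    ∃ g : (Fin n → Bool) → ℝ,
      (∀ s, ∃ y ∈ C, ∑ i, (boolSign (s i) - y i) ^ 2 ≤ g s) ∧
      (∑ s, Real.exp (g s / 32)) * signCount C ≤ 4 ^ n := by
  induction n with
  | zero =>
    classical
    obtain ⟨s, hs⟩ := Finset.card_pos.1 hpos
    refine ⟨fun _ => 0, fun s' => ⟨_, (Finset.mem_filter.1 hs).2, by simp⟩, ?_⟩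
    have : signCount C ≤ 1 := by
      refine (Finset.card_le_univ _).trans ?_
      simp
    simpa using this
  | succ n ih =>
    obtain ⟨b, hb⟩ : ∃ b : Bool,
        signCount {y | (Fin.cons (boolSign (!b)) y : Fin (n + 1) → ℝ) ∈ C} ≤
          signCount {y | (Fin.cons (boolSign b) y : Fin (n + 1) → ℝ) ∈ C} := by
      rcases le_total (signCount {y | (Fin.cons (boolSign false) y : Fin (n + 1) → ℝ) ∈ C})
        (signCount {y | (Fin.cons (boolSign true) y : Fin (n + 1) → ℝ) ∈ C}) with h | h
      · exact ⟨true, h⟩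
      · exact ⟨false, h⟩
    have hadd := signCount_eq_add C b
    set C₀ := {y | (Fin.cons (boolSign b) y : Fin (n + 1) → ℝ) ∈ C} with hC₀
    set C₁ := {y | (Fin.cons (boolSign (!b)) y : Fin (n + 1) → ℝ) ∈ C} with hC₁
    have hpos₀ : 0 < signCount C₀ := by omega
    have hpos₀' : (0 : ℝ) < signCount C₀ := by exact_mod_cast hpos₀
    obtain ⟨g₀, hg₀, hs₀⟩ := ih (convex_cons_preimage hC _) hpos₀
    rw [← hC₀] at hg₀ hs₀
    have hsign : boolSign (!b) ^ 2 = 1 := by rw [← sq_abs, abs_boolSign]; norm_num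
    -- Vectors with first sign `b` use the larger section `C₀` alone. For the other sign a better
    -- bound mixes both sections; its estimate is multiplied by `signCount C₀ ^ 2` to avoid
    -- fractions.
    have hkey : ∃ h : (Fin n → Bool) → ℝ,
        (∀ s, ∃ y ∈ C, (boolSign (!b) - y 0) ^ 2 +
          ∑ i : Fin n, (boolSign (s i) - y i.succ) ^ 2 ≤ h s) ∧
        (∑ s, Real.exp (h s / 32)) * signCount C₀ * signCount C₀ ≤
          4 ^ n * (2 * signCount C₀ - signCount C₁) := by
      rcases Nat.eq_zero_or_pos (signCount C₁) with h0 | hpos₁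
      · refine ⟨fun s => g₀ s + 4, fun s => ?_, ?_⟩
        · obtain ⟨y, hy, hys⟩ := hg₀ s
          refine ⟨_, hy, ?_⟩
          have : (boolSign (!b) - boolSign b) ^ 2 = 4 := by
            rw [boolSign_not] at hsign ⊢
            linear_combination 4 * hsign
          simp only [Fin.cons_zero, Fin.cons_succ]
          linarith
        · have h1 : Real.exp (1 / 8) ≤ 2 := by
            have h2 : Real.exp (1 / 8) * Real.exp (-(1 / 8)) = 1 := by rw [← Real.exp_add]; simp
            have h3 := Real.add_one_le_exp (-(1 / 8) : ℝ)
            nlinarith [Real.exp_pos (1 / 8)]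
          have h2 : ∀ s, Real.exp ((g₀ s + 4) / 32) = Real.exp (g₀ s / 32) * Real.exp (1 / 8) :=
            fun s => by rw [← Real.exp_add]; congr 1; ring
          simp_rw [h2]
          rw [← Finset.sum_mul, h0]
          calc (∑ s, Real.exp (g₀ s / 32)) * Real.exp (1 / 8) * signCount C₀ * signCount C₀
              = ((∑ s, Real.exp (g₀ s / 32)) * signCount C₀) * (Real.exp (1 / 8) * signCount C₀) :=
                by ring
            _ ≤ 4 ^ n * (2 * signCount C₀) := by gcongr
            _ = _ := by simp
      · have hpos₁' : (0 : ℝ) < signCount C₁ := by exact_mod_cast hpos₁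
        obtain ⟨g₁, hg₁, hs₁⟩ := ih (convex_cons_preimage hC _) hpos₁
        rw [← hC₁] at hg₁ hs₁
        have hb' : (signCount C₁ : ℝ) ≤ signCount C₀ := by exact_mod_cast hb
        set u := Real.log (signCount C₀ / signCount C₁) with hu
        have hu0 : 0 ≤ u := Real.log_nonneg ((one_le_div hpos₁').2 hb')
        have hexp : signCount C₀ * Real.exp (-u) = (signCount C₁ : ℝ) := by
          rw [Real.exp_neg, hu, Real.exp_log (by positivity)]
          field_simp
        obtain ⟨l, hl0, hl1, hl⟩ := exists_exp_add_sq_le hu0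
        -- Interpolate between near points of the two sections: the first coordinate moves by `2 *
        -- (1 - l)`, and the other coordinates use convexity of the square.
        refine ⟨fun s => l * g₁ s + (1 - l) * g₀ s + 4 * (1 - l) ^ 2, fun s => ?_, ?_⟩
        · obtain ⟨y₀, hy₀, hys₀⟩ := hg₀ s
          obtain ⟨y₁, hy₁, hys₁⟩ := hg₁ s
          refine ⟨_, hC hy₁ hy₀ hl0 (sub_nonneg.2 hl1) (by ring), ?_⟩
          simp only [Pi.add_apply, Pi.smul_apply, Fin.cons_zero, Fin.cons_succ, smul_eq_mul]
          have h1 : (boolSign (!b) - (l * boolSign (!b) + (1 - l) * boolSign b)) ^ 2 =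
              4 * (1 - l) ^ 2 := by
            rw [boolSign_not] at hsign ⊢
            linear_combination 4 * (1 - l) ^ 2 * hsign
          have h2 : ∑ i, (boolSign (s i) - (l * y₁ i + (1 - l) * y₀ i)) ^ 2 ≤
              l * ∑ i, (boolSign (s i) - y₁ i) ^ 2 +
                (1 - l) * ∑ i, (boolSign (s i) - y₀ i) ^ 2 := by
            rw [Finset.mul_sum, Finset.mul_sum, ← Finset.sum_add_distrib]
            refine Finset.sum_le_sum fun i _ => ?_
            have := mul_nonneg (mul_nonneg hl0 (sub_nonneg.2 hl1)) (sq_nonneg (y₁ i - y₀ i))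
            nlinarith
          have h3 := mul_le_mul_of_nonneg_left hys₁ hl0
          have h4 := mul_le_mul_of_nonneg_left hys₀ (sub_nonneg.2 hl1)
          linarith
        · have hpt : ∀ s, Real.exp ((l * g₁ s + (1 - l) * g₀ s + 4 * (1 - l) ^ 2) / 32) *
              signCount C₀ ≤ (l * (Real.exp (g₁ s / 32) * signCount C₁) +
                (1 - l) * (Real.exp (g₀ s / 32) * signCount C₀)) *
                Real.exp (l * u + (1 - l) ^ 2 / 8) := fun s => by
            -- Convexity of `exp` takes the place of Hölder's inequality. The shift by `u`
            -- compensates for the different sizes of the sections, since `exp (-u)` is their ratio.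
            have h := convexOn_exp.2 (Set.mem_univ (g₁ s / 32 - u)) (Set.mem_univ (g₀ s / 32))
              hl0 (sub_nonneg.2 hl1) (by ring)
            simp only [smul_eq_mul] at h
            calc Real.exp ((l * g₁ s + (1 - l) * g₀ s + 4 * (1 - l) ^ 2) / 32) * signCount C₀
                = Real.exp (l * (g₁ s / 32 - u) + (1 - l) * (g₀ s / 32)) * signCount C₀ *
                    Real.exp (l * u + (1 - l) ^ 2 / 8) := by
                  rw [mul_right_comm, ← Real.exp_add]
                  congr 2
                  ring
              _ ≤ (l * Real.exp (g₁ s / 32 - u) + (1 - l) * Real.exp (g₀ s / 32)) *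
                    signCount C₀ * Real.exp (l * u + (1 - l) ^ 2 / 8) := by gcongr
              _ = _ := by
                  rw [← hexp, sub_eq_add_neg, Real.exp_add]
                  ring
          have hsum : (∑ s, Real.exp ((l * g₁ s + (1 - l) * g₀ s + 4 * (1 - l) ^ 2) / 32)) *
              signCount C₀ ≤ 4 ^ n * (2 - Real.exp (-u)) := by
            rw [Finset.sum_mul]
            refine (Finset.sum_le_sum fun s _ => hpt s).trans ?_
            rw [← Finset.sum_mul, Finset.sum_add_distrib, ← Finset.mul_sum, ← Finset.mul_sum,
              ← Finset.sum_mul, ← Finset.sum_mul]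
            have h3 := mul_le_mul_of_nonneg_left hs₁ hl0
            have h4 := mul_le_mul_of_nonneg_left hs₀ (sub_nonneg.2 hl1)
            gcongr
            linarith
          calc _ ≤ 4 ^ n * (2 - Real.exp (-u)) * signCount C₀ := by gcongr
            _ = _ := by rw [← hexp]; ring
    obtain ⟨h, hh, hhs⟩ := hkey
    refine ⟨fun s => if s 0 = b then g₀ (Fin.tail s) else h (Fin.tail s), fun s => ?_, ?_⟩
    · by_cases hs : s 0 = b
      · obtain ⟨y, hy, hys⟩ := hg₀ (Fin.tail s)
        refine ⟨_, hy, ?_⟩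
        rw [Fin.sum_univ_succ]
        simpa [hs, Fin.tail] using hys
      · obtain ⟨y, hy, hys⟩ := hh (Fin.tail s)
        refine ⟨_, hy, ?_⟩
        have hs' : s 0 = !b := by cases b <;> simpa using hs
        rw [Fin.sum_univ_succ]
        simpa [hs', Fin.tail] using hys
    · rw [sum_cons_eq _ b, hadd]
      have hb1 : (!b) ≠ b := by cases b <;> simp
      simp only [Fin.cons_zero, if_true, Fin.tail_cons, if_neg hb1]
      push_cast
      set a₀ : ℝ := (signCount C₀ : ℝ)
      set a₁ : ℝ := (signCount C₁ : ℝ)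
      have ha₁ : 0 ≤ a₁ := Nat.cast_nonneg _
      set U := ∑ s, Real.exp (g₀ s / 32)
      set W := ∑ s, Real.exp (h s / 32)
      -- With `r = a₁ / a₀` this is `(1 + (2 - r)) * (1 + r) = 4 - (1 - r) ^ 2 ≤ 4`.
      have h1 : (U + W) * (a₀ + a₁) * a₀ ^ 2 ≤ 4 ^ (n + 1) * a₀ ^ 2 := by
        calc (U + W) * (a₀ + a₁) * a₀ ^ 2 = ((U * a₀) * a₀ + W * a₀ * a₀) * (a₀ + a₁) := by ring
          _ ≤ (4 ^ n * a₀ + 4 ^ n * (2 * a₀ - a₁)) * (a₀ + a₁) := by gcongr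
          _ = 4 ^ n * (4 * a₀ ^ 2 - (a₀ - a₁) ^ 2) := by ring
          _ ≤ 4 ^ n * (4 * a₀ ^ 2) := by gcongr; linarith [sq_nonneg (a₀ - a₁)]
          _ = 4 ^ (n + 1) * a₀ ^ 2 := by ring
      exact le_of_mul_le_mul_right h1 (by positivity)

/-! ### Elementary facts on the `K`-functional -/

section KFunctional

variable {𝕜 : Type*} [RCLike 𝕜]

theorem kFunctional_nonneg (a : ℕ → 𝕜) {t : ℝ} (ht : 0 ≤ t) : 0 ≤ kFunctional a t := by
  refine Real.sInf_nonneg ?_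
  rintro r ⟨b, c, -, rfl⟩
  positivity

theorem kFunctional_le {a : ℕ → 𝕜} {t : ℝ} (ht : 0 ≤ t) (b : lp (fun _ : ℕ => 𝕜) 1)
    (c : lp (fun _ : ℕ => 𝕜) 2) (h : ∀ n, a n = b n + c n) :
    kFunctional a t ≤ ‖b‖ + t * ‖c‖ := by
  refine csInf_le ⟨0, ?_⟩ ⟨b, c, h, rfl⟩
  rintro r ⟨b, c, -, rfl⟩
  positivity

theorem exists_decomposition_lt_of_kFunctional_lt {a : ℕ → 𝕜} (ha : Memℓp a 2) {t r : ℝ}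
    (h : kFunctional a t < r) :
    ∃ (b : lp (fun _ : ℕ => 𝕜) 1) (c : lp (fun _ : ℕ => 𝕜) 2),
      (∀ n, a n = b n + c n) ∧ ‖b‖ + t * ‖c‖ < r := by
  obtain ⟨_, ⟨b, c, hbc, rfl⟩, hr⟩ :=
    exists_lt_of_csInf_lt (s := {r : ℝ | ∃ (b : lp (fun _ : ℕ => 𝕜) 1)
      (c : lp (fun _ : ℕ => 𝕜) 2), (∀ n, a n = b n + c n) ∧ r = ‖b‖ + t * ‖c‖})
      ⟨_, 0, ⟨a, ha⟩, fun n => by simp, rfl⟩ h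
  exact ⟨b, c, hbc, hr⟩

theorem sum_norm_le_norm_lp_one (b : lp (fun _ : ℕ => 𝕜) 1) (s : Finset ℕ) :
    ∑ i ∈ s, ‖b i‖ ≤ ‖b‖ := by
  simpa using lp.sum_rpow_le_norm_rpow (p := 1) (by simp) b s

theorem sum_norm_sq_le_norm_sq_lp_two (c : lp (fun _ : ℕ => 𝕜) 2) (s : Finset ℕ) :
    ∑ i ∈ s, ‖c i‖ ^ 2 ≤ ‖c‖ ^ 2 := by
  simpa using lp.sum_rpow_le_norm_rpow (p := 2) (by simp) c s

theorem sum_single_apply {p : ENNReal} (d : ℕ → 𝕜) (N n : ℕ) :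
    (∑ i ∈ Finset.range N, lp.single (E := fun _ : ℕ => 𝕜) p i (d i)) n =
      if n < N then d n else 0 := by
  induction N with
  | zero => simp
  | succ N ih =>
    rw [Finset.sum_range_succ, lp.coeFn_add, Pi.add_apply, ih, lp.single_apply]
    rcases lt_trichotomy n N with h | h | h
    · simp [h, h.ne, Nat.lt_succ_of_lt h]
    · simp [h]
    · simp [h.ne', not_lt.2 h.le, not_lt.2 (Nat.succ_le_of_lt h)]

end KFunctional

/-! ### Finite Rademacher sums in a normed space -/

section Cube

variable {𝕜 : Type*} [RCLike 𝕜] {E : Type*} [NormedAddCommGroup E] [NormedSpace 𝕜 E]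

/-- A sign vector at distance `√g` from the points of the cube where the sum of the series has norm
at most `M` yields a sum of norm at most `M + (2 + √g / t) K^w`. -/
theorem norm_sum_le_of_sq_dist_le {x : ℕ → E} (hx : IsWeaklyEllTwo 𝕜 x) {t K M g : ℝ} (ht : 0 < t)
    (hK : ∀ φ : E →L[𝕜] 𝕜, ‖φ‖ ≤ 1 → kFunctional (fun n => φ (x n)) t ≤ K) {N : ℕ}
    {z y : Fin N → ℝ} (hz : ∀ i, |z i| ≤ 1) (hy : ∀ i, |y i| ≤ 1)
    (hM : ‖∑ i, (y i : 𝕜) • x i‖ ≤ M) (hg : ∑ i, (z i - y i) ^ 2 ≤ g) :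
    ‖∑ i, (z i : 𝕜) • x i‖ ≤ M + (2 + √g / t) * K := by
  obtain ⟨φ, hφ, hφx⟩ := exists_dual_vector'' 𝕜 (∑ i, (z i : 𝕜) • x i)
  have hpos : 0 < 2 + √g / t := by positivity
  -- The infimum defining the `K`-functional need not be attained, so a decomposition is available
  -- only above each `r > K`.
  suffices h : ∀ r, K < r → (‖∑ i, (z i : 𝕜) • x i‖ - M) / (2 + √g / t) ≤ r by
    have := le_of_forall_gt_imp_ge_of_dense h
    rw [div_le_iff₀ hpos] at this
    linarith
  intro r hr
  obtain ⟨b, c, hbc, hlt⟩ := exists_decomposition_lt_of_kFunctional_lt (hx φ)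
    ((hK φ hφ).trans_lt hr)
  have h1 : φ (∑ i, (z i : 𝕜) • x i) = φ (∑ i, (y i : 𝕜) • x i) +
      (∑ i : Fin N, ((z i - y i : ℝ) : 𝕜) * b i + ∑ i : Fin N, ((z i - y i : ℝ) : 𝕜) * c i) := by
    rw [map_sum, map_sum, ← Finset.sum_add_distrib, ← Finset.sum_add_distrib]
    refine Finset.sum_congr rfl fun i _ => ?_
    rw [map_smul, map_smul, hbc i, smul_eq_mul, smul_eq_mul]
    push_cast
    ring
  -- The `ℓ₁` part is paired with `|z i - y i| ≤ 2`, the `ℓ₂` part with the Euclidean distance.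
  have h2 : ‖∑ i : Fin N, ((z i - y i : ℝ) : 𝕜) * b i‖ ≤ 2 * ‖b‖ := by
    calc _ ≤ ∑ i : Fin N, 2 * ‖b i‖ := by
          refine norm_sum_le_of_le _ fun i _ => ?_
          rw [norm_mul, RCLike.norm_ofReal]
          gcongr
          have h3 := abs_sub (z i) (y i)
          linarith [hz i, hy i]
      _ = 2 * ∑ i ∈ Finset.range N, ‖b i‖ := by
          rw [← Finset.mul_sum, Finset.sum_range fun i => ‖b i‖]
      _ ≤ 2 * ‖b‖ := by gcongr; exact sum_norm_le_norm_lp_one b _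
  have h3 : ‖∑ i : Fin N, ((z i - y i : ℝ) : 𝕜) * c i‖ ≤ √g * ‖c‖ := by
    calc _ ≤ ∑ i : Fin N, |z i - y i| * ‖c i‖ := by
          refine norm_sum_le_of_le _ fun i _ => ?_
          rw [norm_mul, RCLike.norm_ofReal]
      _ ≤ √(∑ i, |z i - y i| ^ 2) * √(∑ i : Fin N, ‖c i‖ ^ 2) :=
          Real.sum_mul_le_sqrt_mul_sqrt _ _ _
      _ ≤ √g * ‖c‖ := by
          simp_rw [sq_abs]
          gcongr
          rw [← Finset.sum_range fun i => ‖c i‖ ^ 2]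
          exact Real.sqrt_le_iff.2 ⟨norm_nonneg _, sum_norm_sq_le_norm_sq_lp_two c _⟩
  have h4 : ‖∑ i, (z i : 𝕜) • x i‖ ≤ M + (2 * ‖b‖ + √g * ‖c‖) := by
    calc ‖∑ i, (z i : 𝕜) • x i‖ = ‖φ (∑ i, (z i : 𝕜) • x i)‖ := by rw [hφx]; simp
      _ ≤ ‖φ (∑ i, (y i : 𝕜) • x i)‖ + (‖∑ i : Fin N, ((z i - y i : ℝ) : 𝕜) * b i‖ +
          ‖∑ i : Fin N, ((z i - y i : ℝ) : 𝕜) * c i‖) := by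
          rw [h1]
          exact (norm_add_le _ _).trans (by gcongr; exact norm_add_le _ _)
      _ ≤ M + (2 * ‖b‖ + √g * ‖c‖) := by
          gcongr
          exact (φ.le_of_opNorm_le hφ _).trans (by rwa [one_mul])
  have h5 : (2 + √g / t) * (‖b‖ + t * ‖c‖) ≤ (2 + √g / t) * r := by gcongr
  have h6 : (2 + √g / t) * (‖b‖ + t * ‖c‖) =
      2 * ‖b‖ + √g * ‖c‖ + 2 * (t * ‖c‖) + √g / t * ‖b‖ := by
    field_simp
    ring
  have h7 : 0 ≤ 2 * (t * ‖c‖) := by positivity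
  have h8 : 0 ≤ √g / t * ‖b‖ := by positivity
  rw [div_le_iff₀ hpos]
  linarith

/-- Restricting to the solid cube loses no sign vector, and it keeps the coordinates bounded as
`norm_sum_le_of_sq_dist_le` requires. -/
theorem signCount_inter_cube {N : ℕ} (A : Set (Fin N → ℝ)) :
    signCount (A ∩ {y | ∀ i, |y i| ≤ 1}) = signCount A := by
  classical
  simp [signCount, abs_boolSign]

theorem convex_setOf_norm_sum_le (x : ℕ → E) (M : ℝ) (N : ℕ) :
    Convex ℝ ({y : Fin N → ℝ | ‖∑ i, (y i : 𝕜) • x i‖ ≤ M} ∩ {y | ∀ i, |y i| ≤ 1}) := by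
  rintro y ⟨hy, hy'⟩ z ⟨hz, hz'⟩ a b ha hb hab
  simp only [Set.mem_ofPred_eq] at hy hz hy' hz'
  have h : ∑ i, (((a • y + b • z) i : ℝ) : 𝕜) • x i =
      (a : 𝕜) • ∑ i, (y i : 𝕜) • x i + (b : 𝕜) • ∑ i, (z i : 𝕜) • x i := by
    rw [Finset.smul_sum, Finset.smul_sum, ← Finset.sum_add_distrib]
    refine Finset.sum_congr rfl fun i _ => ?_
    simp [add_smul, mul_smul]
  constructor
  · simp only [Set.mem_ofPred_eq]
    rw [h]
    calc _ ≤ a * ‖∑ i, (y i : 𝕜) • x i‖ + b * ‖∑ i, (z i : 𝕜) • x i‖ := by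
          refine (norm_add_le _ _).trans ?_
          rw [norm_smul, norm_smul, RCLike.norm_ofReal, RCLike.norm_ofReal, abs_of_nonneg ha,
            abs_of_nonneg hb]
      _ ≤ a * M + b * M := by gcongr
      _ = M := by rw [← add_mul, hab, one_mul]
  · intro i
    simp only [Pi.add_apply, Pi.smul_apply, smul_eq_mul]
    calc |a * y i + b * z i| ≤ a * |y i| + b * |z i| := by
          refine (abs_add_le _ _).trans ?_
          rw [abs_mul, abs_mul, abs_of_nonneg ha, abs_of_nonneg hb]
      _ ≤ a * 1 + b * 1 := by gcongr <;> simp [hy', hz']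
      _ = 1 := by linarith

/-- The upper moment bound for finite Rademacher sums. -/
theorem sum_norm_rpow_le {x : ℕ → E} (hx : IsWeaklyEllTwo 𝕜 x) {p K M : ℝ} (hp : 1 ≤ p)
    (hK : ∀ φ : E →L[𝕜] 𝕜, ‖φ‖ ≤ 1 → kFunctional (fun n => φ (x n)) √p ≤ K) (hK0 : 0 ≤ K)
    (hM0 : 0 ≤ M) {N : ℕ}
    (hM : 2 ^ N ≤ 2 * signCount {y : Fin N → ℝ | ‖∑ i, (y i : 𝕜) • x i‖ ≤ M}) :
    ∑ s : Fin N → Bool, ‖∑ i, (boolSign (s i) : 𝕜) • x i‖ ^ p ≤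
      2 ^ N * (2 * (9 * (M + 2 * K)) ^ p) := by
  have hp0 : 0 < p := by linarith
  rw [← signCount_inter_cube] at hM
  set C := {y : Fin N → ℝ | ‖∑ i, (y i : 𝕜) • x i‖ ≤ M} ∩ {y | ∀ i, |y i| ≤ 1} with hC
  have hpos : 0 < signCount C := by
    have : 0 < 2 ^ N := by positivity
    omega
  obtain ⟨g, hg, hs⟩ :=
    exists_sq_dist_le_sum_exp_mul_signCount_le (convex_setOf_norm_sum_le (𝕜 := 𝕜) x M N) hpos
  rw [← hC] at hg hs
  have hpt : ∀ s : Fin N → Bool, ‖∑ i, (boolSign (s i) : 𝕜) • x i‖ ^ p ≤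
      (9 * (M + 2 * K)) ^ p * Real.exp (g s / 32) := fun s => by
    obtain ⟨y, ⟨hyM, hy1⟩, hys⟩ := hg s
    have hg0 : 0 ≤ g s := (Finset.sum_nonneg fun _ _ => sq_nonneg _).trans hys
    have h1 := norm_sum_le_of_sq_dist_le hx (Real.sqrt_pos.2 hp0) hK
      (fun i => (abs_boolSign (s i)).le) hy1 hyM hys
    set z := √(g s) / √p with hz
    have hz0 : 0 ≤ z := by positivity
    have hz2 : z ^ 2 = g s / p := by
      rw [hz, div_pow, Real.sq_sqrt hg0, Real.sq_sqrt hp0.le]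
    have h2 : 1 + z ≤ 9 * Real.exp (g s / 32 / p) := by
      have h3 := Real.add_one_le_exp (z ^ 2 / 32)
      rw [show g s / 32 / p = z ^ 2 / 32 by rw [hz2]; ring]
      nlinarith [sq_nonneg (z - 2)]
    -- The `p` in the denominator of the exponent, due to the parameter `√p`, makes the `p`-th power
    -- exactly `exp (g s / 32)`, which Talagrand's inequality controls.
    have h4 : M + (2 + z) * K ≤ 9 * (M + 2 * K) * Real.exp (g s / 32 / p) := by
      calc M + (2 + z) * K ≤ (M + 2 * K) * (1 + z) := by
            nlinarith [mul_nonneg hM0 hz0, mul_nonneg hK0 hz0]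
        _ ≤ (M + 2 * K) * (9 * Real.exp (g s / 32 / p)) := by gcongr
        _ = _ := by ring
    calc ‖∑ i, (boolSign (s i) : 𝕜) • x i‖ ^ p
        ≤ (9 * (M + 2 * K) * Real.exp (g s / 32 / p)) ^ p :=
          Real.rpow_le_rpow (norm_nonneg _) (h1.trans h4) hp0.le
      _ = (9 * (M + 2 * K)) ^ p * Real.exp (g s / 32) := by
          rw [Real.mul_rpow (by positivity) (Real.exp_pos _).le, ← Real.exp_mul]
          congr 2
          field_simp
  refine (Finset.sum_le_sum fun s _ => hpt s).trans ?_
  rw [← Finset.mul_sum]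
  have h5 : ∑ s, Real.exp (g s / 32) ≤ 2 ^ N * 2 := by
    have hM' : (2 : ℝ) ^ N ≤ 2 * signCount C := by exact_mod_cast hM
    have h6 : (∑ s, Real.exp (g s / 32)) * 2 ^ N ≤ (2 ^ N * 2) * 2 ^ N := by
      calc (∑ s, Real.exp (g s / 32)) * 2 ^ N
          ≤ (∑ s, Real.exp (g s / 32)) * (2 * signCount C) := by
            gcongr
        _ ≤ 2 * 4 ^ N := by linarith
        _ = (2 ^ N * 2) * 2 ^ N := by
            rw [show (4 : ℝ) = 2 * 2 by norm_num, mul_pow]; ring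
    exact le_of_mul_le_mul_right h6 (by positivity)
  calc _ ≤ (9 * (M + 2 * K)) ^ p * (2 ^ N * 2) := by gcongr
    _ = _ := by ring

/-- The lower tail bound for finite scalar Rademacher sums in terms of the `K`-functional; `a` may
be any square-summable sequence, at the price of its tail. -/
theorem exists_kFunctional_le_signCount {a : ℕ → 𝕜} (f : lp (fun _ : ℕ => 𝕜) 2)
    (hf : ∀ n, f n = a n) {m : ℕ} (hm : 1 ≤ m) {t : ℝ} (ht : 0 ≤ t) (htm : t ≤ √m) (N : ℕ) :
    ∃ u : ℝ, kFunctional a t ≤ 48 * u + t * ‖f - ∑ i ∈ Finset.range N, lp.single 2 i (f i)‖ ∧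
      Real.exp (-8 * m) / 8 * 2 ^ N ≤
        signCount {y : Fin N → ℝ | u ≤ ‖∑ i, (y i : 𝕜) * a i‖} := by
  classical
  obtain ⟨b, c, u, hbc, -, hK, hs⟩ := exists_decomposition_tail (fun i : Fin N => a i) hm
  refine ⟨u, ?_, ?_⟩
  · let b' : ℕ → 𝕜 := fun n => if h : n < N then b ⟨n, h⟩ else 0
    let c' : ℕ → 𝕜 := fun n => if h : n < N then c ⟨n, h⟩ else 0
    have hb' : ∀ i : Fin N, b' i = b i := fun i => by simp [b']
    have hc' : ∀ i : Fin N, c' i = c i := fun i => by simp [c']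
    have hnb : ‖∑ i ∈ Finset.range N, lp.single (E := fun _ : ℕ => 𝕜) 1 i (b' i)‖ =
        ∑ i, ‖b i‖ := by
      have := lp.norm_sum_single (E := fun _ : ℕ => 𝕜) (p := 1) (by simp) b' (Finset.range N)
      simp only [ENNReal.toReal_one, Real.rpow_one] at this
      rw [this, Finset.sum_range]
      simp_rw [hb']
    have hnc : ‖∑ i ∈ Finset.range N, lp.single (E := fun _ : ℕ => 𝕜) 2 i (c' i)‖ =
        √(∑ i, ‖c i‖ ^ 2) := by
      have := lp.norm_sum_single (E := fun _ : ℕ => 𝕜) (p := 2) (by simp) c' (Finset.range N)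
      simp only [ENNReal.toReal_ofNat, Real.rpow_ofNat] at this
      rw [← Real.sqrt_sq (norm_nonneg _), this, Finset.sum_range]
      simp_rw [hc']
    -- The terms of `a` beyond `N` all go into the `ℓ₂` part, where their norm tends to `0` as `N`
    -- grows.
    have h1 := kFunctional_le ht (a := a)
      (∑ i ∈ Finset.range N, lp.single (E := fun _ : ℕ => 𝕜) 1 i (b' i))
      (∑ i ∈ Finset.range N, lp.single (E := fun _ : ℕ => 𝕜) 2 i (c' i) +
        (f - ∑ i ∈ Finset.range N, lp.single 2 i (f i))) (fun n => by
        rw [lp.coeFn_add, lp.coeFn_sub, Pi.add_apply, Pi.sub_apply, sum_single_apply,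
          sum_single_apply, sum_single_apply, hf]
        by_cases hn : n < N
        · have := hbc ⟨n, hn⟩
          simp [hn, b', c', this]
        · simp [hn])
    have h2 : t * √(∑ i, ‖c i‖ ^ 2) ≤ √m * √(∑ i, ‖c i‖ ^ 2) := by gcongr
    have h3 := mul_le_mul_of_nonneg_left (norm_add_le
      (∑ i ∈ Finset.range N, lp.single (E := fun _ : ℕ => 𝕜) 2 i (c' i))
      (f - ∑ i ∈ Finset.range N, lp.single 2 i (f i))) ht
    rw [hnb] at h1
    rw [hnc, mul_add] at h3
    linarith
  · simpa [signCount] using hs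

end Cube

/-! ### From counting signs to probabilities -/

theorem signCount_add_signCount_compl {N : ℕ} (A : Set (Fin N → ℝ)) :
    signCount A + signCount Aᶜ = 2 ^ N := by
  classical
  simp only [signCount, Set.mem_compl_iff]
  rw [Finset.card_filter_add_card_filter_not]
  simp

theorem signCount_mono {N : ℕ} {A B : Set (Fin N → ℝ)} (h : A ⊆ B) :
    signCount A ≤ signCount B := by
  classical
  exact Finset.card_le_card fun s hs => by
    simp only [Finset.mem_filter, Finset.mem_univ, true_and] at hs ⊢
    exact h hs

theorem IsRademacherSequence.measurable_signs {Ω : Type*} [MeasurableSpace Ω]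
    {P : Measure Ω} {ε : ℕ → Ω → ℝ} (hε : IsRademacherSequence P ε) (N : ℕ) :
    Measurable fun ω => (fun i : Fin N => decide (ε i ω = 1)) := by
  refine measurable_pi_lambda _ fun i => ?_
  refine measurable_to_bool ?_
  simpa [Set.preimage] using hε.measurable i (measurableSet_singleton 1)

theorem IsRademacherSequence.aestronglyMeasurable_sum {𝕜 : Type*} [RCLike 𝕜] {E : Type*}
    [NormedAddCommGroup E] [NormedSpace 𝕜 E] {Ω : Type*} [MeasurableSpace Ω] {P : Measure Ω}
    {ε : ℕ → Ω → ℝ} (hε : IsRademacherSequence P ε) (x : ℕ → E) (N : ℕ) :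
    AEStronglyMeasurable (fun ω => ∑ n ∈ Finset.range N, ((ε n ω : ℝ) : 𝕜) • x n) P := by
  refine Finset.aestronglyMeasurable_fun_sum _ fun n _ => ?_
  exact (RCLike.continuous_ofReal.measurable.comp (hε.measurable n)).aestronglyMeasurable.smul_const
    (x n)

section Transfer

variable {Ω : Type*} [MeasurableSpace Ω] {P : Measure Ω} [IsProbabilityMeasure P]
  {ε : ℕ → Ω → ℝ}

theorem IsRademacherSequence.ae_eq_boolSign (hε : IsRademacherSequence P ε) :
    ∀ᵐ ω ∂P, ∀ n, ε n ω = boolSign (decide (ε n ω = 1)) := by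
  rw [ae_all_iff]
  intro n
  have hd : Disjoint {ω | ε n ω = 1} {ω | ε n ω = -1} := by
    rw [Set.disjoint_left]
    intro ω h h'
    simp only [Set.mem_ofPred_eq] at h h'
    rw [h] at h'
    norm_num at h'
  have h1 : P ({ω | ε n ω = 1} ∪ {ω | ε n ω = -1}) = 1 := by
    rw [measure_union hd (hε.measurable n (measurableSet_singleton (-1))), hε.prob_one,
      hε.prob_neg_one, ENNReal.add_halves]
  have h2 : ∀ᵐ ω ∂P, ω ∈ {ω | ε n ω = 1} ∪ {ω | ε n ω = -1} :=
    (mem_ae_iff_prob_eq_one ((hε.measurable n (measurableSet_singleton 1)).union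
      (hε.measurable n (measurableSet_singleton (-1))))).2 h1
  filter_upwards [h2] with ω hω
  rcases hω with h | h <;> simp only [Set.mem_ofPred_eq] at h <;> rw [h] <;> norm_num [boolSign]

/-- Independence gives every sign pattern of length `N` probability `2 ^ (-N)`; this identifies
expectations over the first `N` signs with averages over the cube. -/
theorem IsRademacherSequence.map_signs (hε : IsRademacherSequence P ε) (N : ℕ) :
    P.map (fun ω => (fun i : Fin N => decide (ε i ω = 1))) =
      ((2 : ENNReal) ^ N)⁻¹ • Measure.count := by
  refine Measure.ext_of_singleton fun s => ?_
  rw [Measure.map_apply (hε.measurable_signs N) (measurableSet_singleton s)]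
  have h1 : (fun ω => (fun i : Fin N => decide (ε i ω = 1))) ⁻¹' {s} =ᵐ[P]
      ⋂ i ∈ (Finset.univ : Finset (Fin N)), ε i ⁻¹' {boolSign (s i)} := by
    refine eventuallyEq_set.2 ?_
    filter_upwards [hε.ae_eq_boolSign] with ω hω
    simp only [Set.mem_preimage, Set.mem_singleton_iff, Finset.mem_univ, Set.iInter_true,
      Set.mem_iInter, funext_iff]
    refine forall_congr' fun i => ?_
    by_cases h : ε i ω = 1
    · cases hs : s i <;> norm_num [h, boolSign]
    · have := hω i
      simp only [h, decide_false, boolSign] at this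
      cases hs : s i <;> norm_num [this, boolSign]
  change P _ = _
  rw [measure_congr h1]
  have hind : iIndepFun (fun i : Fin N => ε i) P := hε.indep.precomp Fin.val_injective
  rw [hind.measure_inter_preimage_eq_mul _ (fun i _ => measurableSet_singleton _)]
  have h2 : ∀ i : Fin N, P (ε i ⁻¹' {boolSign (s i)}) = 2⁻¹ := fun i => by
    cases hs : s i
    · simpa [boolSign, Set.preimage] using hε.prob_neg_one i
    · simpa [boolSign, Set.preimage] using hε.prob_one i
  simp [h2, ENNReal.inv_pow]

theorem IsRademacherSequence.lintegral_eq (hε : IsRademacherSequence P ε) (N : ℕ)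
    (F : (Fin N → ℝ) → ENNReal) :
    ∫⁻ ω, F (fun i => ε i ω) ∂P = ((2 : ENNReal) ^ N)⁻¹ *
      ∑ s : Fin N → Bool, F (fun i => boolSign (s i)) := by
  have h1 : ∫⁻ ω, F (fun i => ε i ω) ∂P =
      ∫⁻ ω, (fun s : Fin N → Bool => F (fun i => boolSign (s i)))
        (fun i : Fin N => decide (ε i ω = 1)) ∂P := by
    refine lintegral_congr_ae ?_
    filter_upwards [hε.ae_eq_boolSign] with ω hω
    congr 1
    funext i
    exact hω i
  have h2 := lintegral_map (μ := P) (f := fun s : Fin N → Bool => F (fun i => boolSign (s i)))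
    (measurable_of_countable _) (hε.measurable_signs N)
  rw [h1, ← h2, hε.map_signs, lintegral_smul_measure, lintegral_count, tsum_fintype, smul_eq_mul]

theorem IsRademacherSequence.measureReal_eq (hε : IsRademacherSequence P ε) (N : ℕ)
    (A : Set (Fin N → ℝ)) :
    P.real {ω | (fun i : Fin N => ε i ω) ∈ A} = signCount A / 2 ^ N := by
  classical
  have h1 : {ω | (fun i : Fin N => ε i ω) ∈ A} =ᵐ[P]
      (fun ω => (fun i : Fin N => decide (ε i ω = 1))) ⁻¹'
        ((Finset.univ.filter fun s : Fin N → Bool => (fun i => boolSign (s i)) ∈ A :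
          Finset (Fin N → Bool)) : Set (Fin N → Bool)) := by
    refine eventuallyEq_set.2 ?_
    filter_upwards [hε.ae_eq_boolSign] with ω hω
    have : (fun i : Fin N => ε i ω) = fun i : Fin N => boolSign (decide (ε i ω = 1)) :=
      funext fun i => hω i
    change (fun i : Fin N => ε i ω) ∈ A ↔ _
    rw [this]
    simp
  rw [measureReal_congr h1, measureReal_def,
    ← Measure.map_apply (hε.measurable_signs N) (Finset.measurableSet _), hε.map_signs,
    Measure.smul_apply, Measure.count_apply_finset, signCount]
  simp
  ring

/-- Fatou's lemma for the distribution function of an almost sure limit. -/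
theorem eventually_lt_measureReal_of_tendsto {Y : ℕ → Ω → ℝ} {Z : Ω → ℝ}
    (h : ∀ᵐ ω ∂P, Tendsto (fun n => Y n ω) atTop (𝓝 (Z ω))) {c u : ℝ}
    (hc : c < P.real {ω | Z ω < u}) : ∀ᶠ n in atTop, c < P.real {ω | Y n ω < u} := by
  let U : ℕ → Set Ω := fun n => {ω | ∀ k, n ≤ k → Y k ω < u}
  have hmono : Monotone U := fun m n hmn ω hω k hk => hω k (hmn.trans hk)
  have hlim : Tendsto (fun n => P.real (U n)) atTop (𝓝 (P.real (⋃ n, U n))) :=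
    (ENNReal.tendsto_toReal (measure_ne_top _ _)).comp (tendsto_measure_iUnion_atTop hmono)
  have hle : P.real {ω | Z ω < u} ≤ P.real (⋃ n, U n) := by
    refine ENNReal.toReal_mono (measure_ne_top _ _) (measure_mono_ae ?_)
    filter_upwards [h] with ω hω hZ
    obtain ⟨n, hn⟩ := eventually_atTop.1 (hω.eventually (gt_mem_nhds hZ))
    exact Set.mem_iUnion.2 ⟨n, hn⟩
  filter_upwards [hlim.eventually (lt_mem_nhds (hc.trans_le hle))] with n hn
  exact hn.trans_le (measureReal_mono fun ω hω => hω n le_rfl)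

theorem exists_lt_measureReal_norm_lt {E : Type*} [NormedAddCommGroup E] (X : Ω → E) {c : ℝ}
    (hc : c < 1) : ∃ M : ℝ, 0 ≤ M ∧ c < P.real {ω | ‖X ω‖ < M} := by
  let U : ℕ → Set Ω := fun n => {ω | ‖X ω‖ < n}
  have hmono : Monotone U := fun m n hmn ω hω =>
    lt_of_lt_of_le (show ‖X ω‖ < m from hω) (by exact_mod_cast hmn)
  have hU : ⋃ n, U n = Set.univ := Set.eq_univ_of_forall fun ω => by
    obtain ⟨n, hn⟩ := exists_nat_gt ‖X ω‖
    exact Set.mem_iUnion.2 ⟨n, hn⟩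
  have hlim : Tendsto (fun n => P.real (U n)) atTop (𝓝 (P.real (⋃ n, U n))) :=
    (ENNReal.tendsto_toReal (measure_ne_top _ _)).comp (tendsto_measure_iUnion_atTop hmono)
  rw [hU, probReal_univ] at hlim
  obtain ⟨n, hn⟩ := (hlim.eventually (lt_mem_nhds hc)).exists
  exact ⟨n, Nat.cast_nonneg _, hn⟩

/-- Markov's inequality; the strict hypothesis forces `M > 0` even when the integral vanishes. -/
theorem half_lt_measureReal_norm_lt {E : Type*} [NormedAddCommGroup E] {X : Ω → E}
    (hX : Integrable X P) {M : ℝ} (hM : 2 * ∫ ω, ‖X ω‖ ∂P < M) :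
    1 / 2 < P.real {ω | ‖X ω‖ < M} := by
  have h1 := mul_meas_ge_le_integral_of_nonneg (μ := P) (f := fun ω => ‖X ω‖)
    (ae_of_all _ fun _ => norm_nonneg _) hX.norm M
  have h2 : (1 : ℝ) ≤ P.real {ω | ‖X ω‖ < M} + P.real {ω | M ≤ ‖X ω‖} := by
    rw [← probReal_univ (μ := P)]
    refine (measureReal_mono ?_).trans (measureReal_union_le _ _)
    intro ω _
    exact lt_or_ge ‖X ω‖ M
  have h0 : 0 ≤ ∫ ω, ‖X ω‖ ∂P := integral_nonneg fun _ => norm_nonneg _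
  have hM0 : 0 < M := by linarith
  by_contra! h
  nlinarith

end Transfer

/-! ### Almost surely convergent series -/

section Series

variable {𝕜 : Type*} [RCLike 𝕜] {E : Type*} [NormedAddCommGroup E] [NormedSpace 𝕜 E]
  {Ω : Type*} [MeasurableSpace Ω] {P : Measure Ω} [IsProbabilityMeasure P] {ε : ℕ → Ω → ℝ}
  {x : ℕ → E} {X : Ω → E}

theorem IsRademacherSequence.eventually_lt_signCount (hε : IsRademacherSequence P ε)
    (hX : ∀ᵐ ω ∂P, Tendsto (fun N : ℕ => ∑ n ∈ Finset.range N, ((ε n ω : ℝ) : 𝕜) • x n) atTop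
      (𝓝 (X ω))) {c M : ℝ} (hc : c < P.real {ω | ‖X ω‖ < M}) :
    ∀ᶠ N in atTop, c * 2 ^ N < signCount {y : Fin N → ℝ | ‖∑ i, (y i : 𝕜) • x i‖ < M} := by
  have h := eventually_lt_measureReal_of_tendsto
    (Y := fun N ω => ‖∑ n ∈ Finset.range N, ((ε n ω : ℝ) : 𝕜) • x n‖)
    (hX.mono fun ω hω => hω.norm) hc
  filter_upwards [h] with N hN
  rw [← lt_div_iff₀ (by positivity), ← hε.measureReal_eq]
  simp only [Finset.sum_range] at hN
  exact hN

/-- An almost surely convergent Rademacher series is weakly-`ℓ₂`, with a uniform bound. -/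
theorem IsRademacherSequence.exists_sum_norm_sq_le (hε : IsRademacherSequence P ε)
    (hX : ∀ᵐ ω ∂P, Tendsto (fun N : ℕ => ∑ n ∈ Finset.range N, ((ε n ω : ℝ) : 𝕜) • x n) atTop
      (𝓝 (X ω))) :
    ∃ B : ℝ, 0 ≤ B ∧ ∀ (φ : E →L[𝕜] 𝕜) (N : ℕ),
      ∑ n ∈ Finset.range N, ‖φ (x n)‖ ^ 2 ≤ (B * ‖φ‖) ^ 2 := by
  -- Integrability of `X` is not known here, so a quantile is used. Its level is complementary to
  -- the scalar tail bound with `m = 1`: if `u > ‖φ‖ * M`, two disjoint events would have total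
  -- probability above `1`.
  have hδ : 1 - Real.exp (-8) / 8 < 1 := by linarith [Real.exp_pos (-8)]
  obtain ⟨M, hM0, hM⟩ := exists_lt_measureReal_norm_lt (P := P) X hδ
  obtain ⟨N₀, hN₀⟩ := eventually_atTop.1 (hε.eventually_lt_signCount hX hM)
  refine ⟨96 * M, by positivity, fun φ N' => ?_⟩
  set N := max N₀ N' with hN
  have hcount := hN₀ N (le_max_left _ _)
  obtain ⟨b, c, u, hbc, hu0, hK, hs⟩ :=
    exists_decomposition_tail (fun i : Fin N => φ (x i)) le_rfl
  have hu : u ≤ ‖φ‖ * M := by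
    by_contra! hlt
    have hsub : {y : Fin N → ℝ | u ≤ ‖∑ i, (y i : 𝕜) * φ (x i)‖} ⊆
        {y : Fin N → ℝ | ‖∑ i, (y i : 𝕜) • x i‖ < M}ᶜ := by
      intro y hy hy'
      simp only [Set.mem_ofPred_eq] at hy hy'
      have h1 : φ (∑ i, (y i : 𝕜) • x i) = ∑ i, (y i : 𝕜) * φ (x i) := by
        rw [map_sum]
        simp
      rw [← h1] at hy
      have h2 := φ.le_opNorm (∑ i, (y i : 𝕜) • x i)
      have h3 := mul_le_mul_of_nonneg_left hy'.le (norm_nonneg φ)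
      linarith
    have h1 : Real.exp (-8) / 8 * 2 ^ N ≤
        signCount {y : Fin N → ℝ | u ≤ ‖∑ i, (y i : 𝕜) * φ (x i)‖} := by
      simpa [signCount] using hs
    have h2 : (signCount {y : Fin N → ℝ | u ≤ ‖∑ i, (y i : 𝕜) * φ (x i)‖} : ℝ) ≤
        signCount {y : Fin N → ℝ | ‖∑ i, (y i : 𝕜) • x i‖ < M}ᶜ := by
      exact_mod_cast signCount_mono hsub
    have h3 : (signCount {y : Fin N → ℝ | ‖∑ i, (y i : 𝕜) • x i‖ < M} : ℝ) +
        signCount {y : Fin N → ℝ | ‖∑ i, (y i : 𝕜) • x i‖ < M}ᶜ = 2 ^ N := by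
      exact_mod_cast signCount_add_signCount_compl _
    linarith
  simp only [Nat.cast_one, Real.sqrt_one, one_mul] at hK
  have hb0 : 0 ≤ ∑ i, ‖b i‖ := Finset.sum_nonneg fun _ _ => norm_nonneg _
  have hc0 : 0 ≤ ∑ i, ‖c i‖ ^ 2 := Finset.sum_nonneg fun _ _ => sq_nonneg _
  have hb : ∑ i, ‖b i‖ ^ 2 ≤ (48 * (‖φ‖ * M)) ^ 2 := by
    calc ∑ i, ‖b i‖ ^ 2 ≤ (∑ i, ‖b i‖) ^ 2 :=
          Finset.sum_sq_le_sq_sum_of_nonneg fun _ _ => norm_nonneg _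
      _ ≤ (48 * (‖φ‖ * M)) ^ 2 := by
          gcongr
          linarith [Real.sqrt_nonneg (∑ i, ‖c i‖ ^ 2)]
  have hc : ∑ i, ‖c i‖ ^ 2 ≤ (48 * (‖φ‖ * M)) ^ 2 := by
    rw [← Real.sq_sqrt hc0]
    gcongr
    linarith
  calc ∑ n ∈ Finset.range N', ‖φ (x n)‖ ^ 2 ≤ ∑ n ∈ Finset.range N, ‖φ (x n)‖ ^ 2 :=
        Finset.sum_le_sum_of_subset_of_nonneg
          (Finset.range_subset_range.2 (le_max_right _ _)) fun _ _ _ => sq_nonneg _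
    _ = ∑ i : Fin N, ‖φ (x i)‖ ^ 2 := Finset.sum_range fun n => ‖φ (x n)‖ ^ 2
    _ ≤ ∑ i, (2 * ‖b i‖ ^ 2 + 2 * ‖c i‖ ^ 2) := by
        refine Finset.sum_le_sum fun i _ => ?_
        rw [hbc i]
        have := pow_le_pow_left₀ (norm_nonneg _) (norm_add_le (b i) (c i)) 2
        nlinarith [sq_nonneg (‖b i‖ - ‖c i‖)]
    _ = 2 * ∑ i, ‖b i‖ ^ 2 + 2 * ∑ i, ‖c i‖ ^ 2 := by
        rw [Finset.sum_add_distrib, Finset.mul_sum, Finset.mul_sum]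
    _ ≤ (96 * M * ‖φ‖) ^ 2 := by nlinarith

theorem IsRademacherSequence.isWeaklyEllTwo (hε : IsRademacherSequence P ε)
    (hX : ∀ᵐ ω ∂P, Tendsto (fun N : ℕ => ∑ n ∈ Finset.range N, ((ε n ω : ℝ) : 𝕜) • x n) atTop
      (𝓝 (X ω))) : IsWeaklyEllTwo 𝕜 x := by
  obtain ⟨B, -, hB⟩ := hε.exists_sum_norm_sq_le hX
  intro φ
  refine memℓp_gen ?_
  simp only [ENNReal.toReal_ofNat, Real.rpow_ofNat]
  exact summable_of_sum_range_le (fun _ => sq_nonneg _) (hB φ)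

theorem IsRademacherSequence.bddAbove_weakKValues (hε : IsRademacherSequence P ε)
    (hX : ∀ᵐ ω ∂P, Tendsto (fun N : ℕ => ∑ n ∈ Finset.range N, ((ε n ω : ℝ) : 𝕜) • x n) atTop
      (𝓝 (X ω))) {t : ℝ} (ht : 0 ≤ t) : BddAbove (weakKValues 𝕜 x t) := by
  obtain ⟨B, hB0, hB⟩ := hε.exists_sum_norm_sq_le hX
  refine ⟨t * B, ?_⟩
  rintro r ⟨φ, hφ, rfl⟩
  have hmem : Memℓp (fun n => φ (x n)) 2 := hε.isWeaklyEllTwo hX φ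
  refine (kFunctional_le ht 0 ⟨_, hmem⟩ fun n => by simp).trans ?_
  rw [norm_zero, zero_add]
  gcongr
  refine lp.norm_le_of_forall_sum_le (by simp) hB0 fun s => ?_
  simp only [ENNReal.toReal_ofNat, Real.rpow_ofNat]
  obtain ⟨N, hN⟩ := s.exists_nat_subset_range
  calc ∑ i ∈ s, ‖φ (x i)‖ ^ 2 ≤ ∑ n ∈ Finset.range N, ‖φ (x n)‖ ^ 2 :=
        Finset.sum_le_sum_of_subset_of_nonneg hN fun _ _ _ => sq_nonneg _
    _ ≤ (B * ‖φ‖) ^ 2 := hB φ N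
    _ ≤ (B * 1) ^ 2 := by gcongr
    _ = B ^ 2 := by rw [mul_one]

/-- The finite bound passes to the limit by Fatou's lemma. Only a quantile `M` of `‖X‖` enters, so
finiteness of the moments can be deduced from it without circularity. -/
theorem IsRademacherSequence.lintegral_norm_rpow_le (hε : IsRademacherSequence P ε)
    (hX : ∀ᵐ ω ∂P, Tendsto (fun N : ℕ => ∑ n ∈ Finset.range N, ((ε n ω : ℝ) : 𝕜) • x n) atTop
      (𝓝 (X ω))) {p M : ℝ} (hp : 1 ≤ p) (hM0 : 0 ≤ M) (hM : 1 / 2 < P.real {ω | ‖X ω‖ < M}) :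
    ∫⁻ ω, ENNReal.ofReal (‖X ω‖ ^ p) ∂P ≤
      ENNReal.ofReal (2 * (9 * (M + 2 * weakKFunctional 𝕜 x √p)) ^ p) := by
  have hp0 : 0 < p := by linarith
  have hx := hε.isWeaklyEllTwo hX
  have hbdd := hε.bddAbove_weakKValues hX (Real.sqrt_nonneg p)
  have hK : ∀ φ : E →L[𝕜] 𝕜, ‖φ‖ ≤ 1 →
      kFunctional (fun n => φ (x n)) √p ≤ weakKFunctional 𝕜 x √p := fun φ hφ =>
    le_csSup hbdd ⟨φ, hφ, rfl⟩
  have hK0 : 0 ≤ weakKFunctional 𝕜 x √p :=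
    (kFunctional_nonneg _ (Real.sqrt_nonneg p)).trans (hK 0 (by simp))
  have hN : ∀ᶠ N in atTop, ∫⁻ ω, ENNReal.ofReal
      (‖∑ n ∈ Finset.range N, ((ε n ω : ℝ) : 𝕜) • x n‖ ^ p) ∂P ≤
      ENNReal.ofReal (2 * (9 * (M + 2 * weakKFunctional 𝕜 x √p)) ^ p) := by
    filter_upwards [hε.eventually_lt_signCount hX hM] with N hN
    have h1 : (signCount {y : Fin N → ℝ | ‖∑ i, (y i : 𝕜) • x i‖ < M} : ℝ) ≤
        signCount {y : Fin N → ℝ | ‖∑ i, (y i : 𝕜) • x i‖ ≤ M} :=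
      Nat.cast_le.2 (signCount_mono fun y (hy : ‖_‖ < M) => show ‖_‖ ≤ M from hy.le)
    have h2 := sum_norm_rpow_le hx hp hK hK0 hM0 (N := N) (by
      have : (2 : ℝ) ^ N ≤ 2 * signCount {y : Fin N → ℝ | ‖∑ i, (y i : 𝕜) • x i‖ ≤ M} := by
        linarith
      exact_mod_cast this)
    simp_rw [Finset.sum_range]
    rw [hε.lintegral_eq N fun y => ENNReal.ofReal (‖∑ i, (y i : 𝕜) • x i‖ ^ p),
      ← ENNReal.ofReal_sum_of_nonneg fun _ _ => by positivity]
    calc _ ≤ ((2 : ENNReal) ^ N)⁻¹ * ENNReal.ofReal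
          (2 ^ N * (2 * (9 * (M + 2 * weakKFunctional 𝕜 x √p)) ^ p)) := by gcongr
      _ = _ := by
          rw [ENNReal.ofReal_mul (by positivity), ENNReal.ofReal_pow (by norm_num),
            ENNReal.ofReal_ofNat, ← mul_assoc, ENNReal.inv_mul_cancel (by simp) (by simp), one_mul]
  calc ∫⁻ ω, ENNReal.ofReal (‖X ω‖ ^ p) ∂P
      = ∫⁻ ω, liminf (fun N => ENNReal.ofReal
          (‖∑ n ∈ Finset.range N, ((ε n ω : ℝ) : 𝕜) • x n‖ ^ p)) atTop ∂P := by
        refine lintegral_congr_ae ?_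
        filter_upwards [hX] with ω hω
        exact ((ENNReal.continuous_ofReal.tendsto _).comp
          (hω.norm.rpow_const (Or.inr hp0.le))).liminf_eq.symm
    _ ≤ liminf (fun N => ∫⁻ ω, ENNReal.ofReal
          (‖∑ n ∈ Finset.range N, ((ε n ω : ℝ) : 𝕜) • x n‖ ^ p) ∂P) atTop :=
        lintegral_liminf_le' fun N =>
          ((hε.aestronglyMeasurable_sum x N).norm.aemeasurable.pow_const p).ennreal_ofReal
    _ ≤ _ := by
        refine (liminf_le_liminf hN).trans ?_
        simp

theorem IsRademacherSequence.memLp (hε : IsRademacherSequence P ε)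
    (hX : ∀ᵐ ω ∂P, Tendsto (fun N : ℕ => ∑ n ∈ Finset.range N, ((ε n ω : ℝ) : 𝕜) • x n) atTop
      (𝓝 (X ω))) {p : ℝ} (hp : 1 ≤ p) : MemLp X (ENNReal.ofReal p) P := by
  have hp0 : 0 < p := by linarith
  have hmeas : AEStronglyMeasurable X P :=
    aestronglyMeasurable_of_tendsto_ae atTop (fun N => hε.aestronglyMeasurable_sum x N) hX
  obtain ⟨M, hM0, hM⟩ := exists_lt_measureReal_norm_lt (P := P) X (c := 1 / 2) (by norm_num)
  have h := hε.lintegral_norm_rpow_le hX hp hM0 hM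
  rw [← integrable_norm_rpow_iff hmeas (by simpa using hp0) (by simp), ENNReal.toReal_ofReal hp0.le]
  refine ⟨(hmeas.norm.aemeasurable.pow_const p).aestronglyMeasurable, ?_⟩
  rw [hasFiniteIntegral_iff_ofReal (ae_of_all _ fun _ => by positivity)]
  exact h.trans_lt ENNReal.ofReal_lt_top

theorem IsRademacherSequence.integral_norm_rpow_rpow_le (hε : IsRademacherSequence P ε)
    (hX : ∀ᵐ ω ∂P, Tendsto (fun N : ℕ => ∑ n ∈ Finset.range N, ((ε n ω : ℝ) : 𝕜) • x n) atTop
      (𝓝 (X ω))) {p : ℝ} (hp : 1 ≤ p) :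
    (∫ ω, ‖X ω‖ ^ p ∂P) ^ (1 / p) ≤
      36 * ((∫ ω, ‖X ω‖ ∂P) + weakKFunctional 𝕜 x √p) := by
  have hp0 : 0 < p := by linarith
  have hint : Integrable X P := by
    have := hε.memLp hX le_rfl
    rwa [ENNReal.ofReal_one, memLp_one_iff_integrable] at this
  have hintp : Integrable (fun ω => ‖X ω‖ ^ p) P := by
    have := (hε.memLp hX hp).integrable_norm_rpow (by simpa using hp0) (by simp)
    rwa [ENNReal.toReal_ofReal hp0.le] at this
  have hE0 : 0 ≤ ∫ ω, ‖X ω‖ ∂P := integral_nonneg fun _ => norm_nonneg _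
  have hK0 : 0 ≤ weakKFunctional 𝕜 x √p :=
    (kFunctional_nonneg _ (Real.sqrt_nonneg p)).trans
      (le_csSup (hε.bddAbove_weakKValues hX (Real.sqrt_nonneg p)) ⟨0, by simp, rfl⟩)
  set K := weakKFunctional 𝕜 x √p with hKdef
  set R := (∫ ω, ‖X ω‖ ^ p ∂P) ^ (1 / p) with hR
  -- The bound `R ≤ 18 * (M + 2 * K)` with `M` decreasing to `2 * ∫ ‖X‖` gives the constant `36`.
  suffices h : ∀ M, 2 * ∫ ω, ‖X ω‖ ∂P < M → R / 18 - 2 * K ≤ M by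
    have := le_of_forall_gt_imp_ge_of_dense h
    linarith
  intro M hM
  have hM0 : 0 ≤ M := by linarith
  have h1 := hε.lintegral_norm_rpow_le hX hp hM0 (half_lt_measureReal_norm_lt hint hM)
  rw [← ofReal_integral_eq_lintegral_ofReal hintp (ae_of_all _ fun _ => by positivity),
    ENNReal.ofReal_le_ofReal_iff (by positivity), ← hKdef] at h1
  have h2 : (2 : ℝ) ≤ 2 ^ p := by
    calc (2 : ℝ) = 2 ^ (1 : ℝ) := (Real.rpow_one 2).symm
      _ ≤ 2 ^ p := Real.rpow_le_rpow_of_exponent_le (by norm_num) hp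
  have h3 : ∫ ω, ‖X ω‖ ^ p ∂P ≤ (18 * (M + 2 * K)) ^ p := by
    calc _ ≤ 2 * (9 * (M + 2 * K)) ^ p := h1
      _ ≤ 2 ^ p * (9 * (M + 2 * K)) ^ p := by gcongr
      _ = (18 * (M + 2 * K)) ^ p := by
          rw [← Real.mul_rpow (by norm_num) (by positivity)]
          congr 1
          ring
  have h4 : R ≤ 18 * (M + 2 * K) := by
    rw [hR, one_div]
    exact (Real.rpow_inv_le_iff_of_pos (integral_nonneg fun _ => by positivity) (by positivity)
      hp0).2 h3
  linarith

/-- Since `⌈p⌉₊ ≤ p + 1 ≤ 2 * p`, the scalar tail probability is at least the `p`-th power of a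
fixed constant, which the `p`-th root turns into an absolute factor. -/
theorem exp_neg_sixteen_div_eight_rpow_le {p : ℝ} (hp : 1 ≤ p) :
    (Real.exp (-16) / 8) ^ p ≤ Real.exp (-8 * ⌈p⌉₊) / 8 := by
  have h1 := (Nat.ceil_lt_add_one (show 0 ≤ p by linarith)).le
  rw [Real.div_rpow (Real.exp_pos _).le (by norm_num), ← Real.exp_mul]
  have h2 : (8 : ℝ) ≤ 8 ^ p := by
    calc (8 : ℝ) = 8 ^ (1 : ℝ) := (Real.rpow_one 8).symm
      _ ≤ 8 ^ p := Real.rpow_le_rpow_of_exponent_le (by norm_num) hp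
  exact div_le_div₀ (Real.exp_pos _).le (Real.exp_le_exp.2 (by linarith)) (by norm_num) h2

theorem IsRademacherSequence.weakKFunctional_le (hε : IsRademacherSequence P ε)
    (hX : ∀ᵐ ω ∂P, Tendsto (fun N : ℕ => ∑ n ∈ Finset.range N, ((ε n ω : ℝ) : 𝕜) • x n) atTop
      (𝓝 (X ω))) {p : ℝ} (hp : 1 ≤ p) :
    weakKFunctional 𝕜 x √p ≤ 384 * Real.exp 16 * (∫ ω, ‖X ω‖ ^ p ∂P) ^ (1 / p) := by
  have hp0 : 0 < p := by linarith
  have hintp : Integrable (fun ω => ‖X ω‖ ^ p) P := by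
    have := (hε.memLp hX hp).integrable_norm_rpow (by simpa using hp0) (by simp)
    rwa [ENNReal.toReal_ofReal hp0.le] at this
  have hI0 : 0 ≤ ∫ ω, ‖X ω‖ ^ p ∂P := integral_nonneg fun _ => by positivity
  refine csSup_le ⟨_, 0, by simp, rfl⟩ ?_
  rintro r ⟨φ, hφ, rfl⟩
  refine le_of_forall_lt_imp_le_of_dense fun r hr => ?_
  rcases le_or_gt r 0 with hr0 | hr0
  · exact hr0.trans (by positivity)
  set t := √p with ht
  have ht0 : 0 ≤ t := Real.sqrt_nonneg _
  have hm : 1 ≤ ⌈p⌉₊ := Nat.one_le_ceil_iff.2 hp0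
  have htm : t ≤ √(⌈p⌉₊ : ℝ) := Real.sqrt_le_sqrt (Nat.le_ceil p)
  set δ := Real.exp (-8 * ⌈p⌉₊) / 8 with hδ
  let f : lp (fun _ : ℕ => 𝕜) 2 := ⟨_, hε.isWeaklyEllTwo hX φ⟩
  have hf : ∀ n, f n = φ (x n) := fun n => rfl
  have htail : Tendsto (fun N => t * ‖f - ∑ i ∈ Finset.range N, lp.single 2 i (f i)‖) atTop
      (𝓝 0) := by
    have h1 := (lp.hasSum_single (by simp) f).tendsto_sum_nat
    have h2 := ((tendsto_const_nhds (x := f)).sub h1).norm.const_mul t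
    simpa using h2
  -- Taking `r` strictly below the `K`-functional leaves room for the discarded `ℓ₂` tail once `N`
  -- is large. The negated form is what contradicts `eventually_lt_measureReal_of_tendsto` in the
  -- limit.
  have hlow : ∀ᶠ N in atTop, ¬ (1 - δ <
      P.real {ω | ‖φ (∑ n ∈ Finset.range N, ((ε n ω : ℝ) : 𝕜) • x n)‖ < r / 48}) := by
    filter_upwards [htail.eventually (gt_mem_nhds (sub_pos.2 hr))] with N hN
    obtain ⟨u, hu, hs⟩ := exists_kFunctional_le_signCount f hf hm ht0 htm N
    rw [← hδ] at hs
    have hru : r / 48 ≤ u := by linarith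
    set A := {y : Fin N → ℝ | ‖∑ i, (y i : 𝕜) * φ (x i)‖ < r / 48} with hA
    have hsub : {y : Fin N → ℝ | u ≤ ‖∑ i, (y i : 𝕜) * φ (x i)‖} ⊆ Aᶜ := by
      intro y hy hy'
      simp only [hA, Set.mem_ofPred_eq] at hy hy'
      linarith
    have h1 : (signCount {y : Fin N → ℝ | u ≤ ‖∑ i, (y i : 𝕜) * φ (x i)‖} : ℝ) ≤
        signCount Aᶜ := by exact_mod_cast signCount_mono hsub
    have h2 : (signCount A : ℝ) + signCount Aᶜ = 2 ^ N := by
      exact_mod_cast signCount_add_signCount_compl A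
    have h3 : {ω | ‖φ (∑ n ∈ Finset.range N, ((ε n ω : ℝ) : 𝕜) • x n)‖ < r / 48} =
        {ω | (fun i : Fin N => ε i ω) ∈ A} := by
      ext ω
      simp only [hA, Set.mem_ofPred_eq, map_sum, map_smul, smul_eq_mul]
      rw [Finset.sum_range fun n => ((ε n ω : ℝ) : 𝕜) * φ (x n)]
    rw [h3, hε.measureReal_eq, not_lt, div_le_iff₀ (by positivity)]
    linarith
  have hup : P.real {ω | ‖φ (X ω)‖ < r / 48} ≤ 1 - δ := by
    by_contra! hlt
    have := eventually_lt_measureReal_of_tendsto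
      (Y := fun N ω => ‖φ (∑ n ∈ Finset.range N, ((ε n ω : ℝ) : 𝕜) • x n)‖)
      (hX.mono fun ω hω => ((φ.continuous.tendsto _).comp hω).norm) hlt
    obtain ⟨N, hN, hN'⟩ := (hlow.and this).exists
    exact hN hN'
  have hge : δ ≤ P.real {ω | (r / 48) ^ p ≤ ‖X ω‖ ^ p} := by
    have h1 : (1 : ℝ) ≤ P.real {ω | ‖φ (X ω)‖ < r / 48} +
        P.real {ω | (r / 48) ^ p ≤ ‖X ω‖ ^ p} := by
      rw [← probReal_univ (μ := P)]
      refine (measureReal_mono ?_).trans (measureReal_union_le _ _)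
      intro ω _
      rcases lt_or_ge ‖φ (X ω)‖ (r / 48) with h | h
      · exact Or.inl h
      · refine Or.inr ?_
        have h2 : ‖φ (X ω)‖ ≤ ‖X ω‖ := by simpa using φ.le_of_opNorm_le hφ (X ω)
        exact Real.rpow_le_rpow (by positivity) (h.trans h2) hp0.le
    linarith
  have hmarkov := mul_meas_ge_le_integral_of_nonneg (μ := P) (f := fun ω => ‖X ω‖ ^ p)
    (ae_of_all _ fun _ => by positivity) hintp ((r / 48) ^ p)
  have h1 : (r / 48 * (Real.exp (-16) / 8)) ^ p ≤ ∫ ω, ‖X ω‖ ^ p ∂P := by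
    rw [Real.mul_rpow (by positivity) (by positivity)]
    calc _ ≤ (r / 48) ^ p * P.real {ω | (r / 48) ^ p ≤ ‖X ω‖ ^ p} := by
          gcongr
          exact (exp_neg_sixteen_div_eight_rpow_le hp).trans hge
      _ ≤ _ := hmarkov
  have h2 : r / 48 * (Real.exp (-16) / 8) ≤ (∫ ω, ‖X ω‖ ^ p ∂P) ^ (1 / p) := by
    rw [one_div]
    exact (Real.le_rpow_inv_iff_of_pos (by positivity) hI0 hp0).2 h1
  calc r = 384 * Real.exp 16 * (r / 48 * (Real.exp (-16) / 8)) := by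
        rw [Real.exp_neg]
        field_simp
        norm_num
    _ ≤ _ := by gcongr

theorem integral_norm_le_integral_rpow {p : ℝ} (hp : 1 ≤ p)
    (hX : MemLp X (ENNReal.ofReal p) P) :
    ∫ ω, ‖X ω‖ ∂P ≤ (∫ ω, ‖X ω‖ ^ p ∂P) ^ (1 / p) := by
  have hp0 : 0 < p := by linarith
  have hint : Integrable (fun ω => ‖X ω‖) P :=
    (hX.integrable (by simpa using hp)).norm
  have hintp : Integrable (fun ω => ‖X ω‖ ^ p) P := by
    have := hX.integrable_norm_rpow (by simpa using hp0) (by simp)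
    rwa [ENNReal.toReal_ofReal hp0.le] at this
  have h := (convexOn_rpow hp).map_integral_le
    (Real.continuous_rpow_const hp0.le).continuousOn isClosed_Ici
    (ae_of_all P fun ω => norm_nonneg (X ω)) hint hintp
  rw [one_div]
  exact (Real.le_rpow_inv_iff_of_pos (integral_nonneg fun _ => norm_nonneg _)
    (integral_nonneg fun _ => by positivity) hp0).2 h

end Series

theorem corollary3 :
    ∃ C : ℝ, 0 < C ∧
      ∀ (𝕜 : Type*) [RCLike 𝕜] (E : Type*) [NormedAddCommGroup E] [NormedSpace 𝕜 E]
        [CompleteSpace E] (Ω : Type*) [MeasurableSpace Ω] (P : Measure Ω) [IsProbabilityMeasure P]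
        (ε : ℕ → Ω → ℝ), IsRademacherSequence P ε →
      ∀ (x : ℕ → E) (X : Ω → E),
        (∀ᵐ ω ∂P, Tendsto (fun N : ℕ => ∑ n ∈ Finset.range N, ((ε n ω : ℝ) : 𝕜) • x n) atTop
          (𝓝 (X ω))) →
        IsWeaklyEllTwo 𝕜 x ∧
        ∀ p : ℝ, 1 ≤ p →
          MemLp X (ENNReal.ofReal p) P ∧
          BddAbove (weakKValues 𝕜 x (√p)) ∧
          (1 / C) * (∫ ω, ‖X ω‖ ^ p ∂P) ^ (1 / p) ≤
            (∫ ω, ‖X ω‖ ∂P) + weakKFunctional 𝕜 x (√p) ∧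
          (∫ ω, ‖X ω‖ ∂P) + weakKFunctional 𝕜 x (√p) ≤
            C * (∫ ω, ‖X ω‖ ^ p ∂P) ^ (1 / p) := by
  -- The sum of the constants of the two directions; the `36` also covers the coefficient `1` from
  -- `E‖X‖ ≤ (E‖X‖^p)^(1/p)`.
  refine ⟨384 * Real.exp 16 + 36, by positivity, ?_⟩
  intro 𝕜 _ E _ _ _ Ω _ P _ ε hε x X hX
  refine ⟨hε.isWeaklyEllTwo hX, fun p hp => ⟨hε.memLp hX hp,
    hε.bddAbove_weakKValues hX (Real.sqrt_nonneg p), ?_, ?_⟩⟩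
  · have h1 := hε.integral_norm_rpow_rpow_le hX hp
    have hR : 0 ≤ (∫ ω, ‖X ω‖ ^ p ∂P) ^ (1 / p) :=
      Real.rpow_nonneg (integral_nonneg fun _ => by positivity) _
    have hpos : 0 < 384 * Real.exp 16 + 36 := by positivity
    rw [one_div_mul_eq_div, div_le_iff₀ hpos]
    have := Real.exp_pos 16
    nlinarith
  · have h1 := hε.weakKFunctional_le hX hp
    have h2 := integral_norm_le_integral_rpow hp (hε.memLp hX hp)
    have hR : 0 ≤ (∫ ω, ‖X ω‖ ^ p ∂P) ^ (1 / p) :=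
      Real.rpow_nonneg (integral_nonneg fun _ => by positivity) _
    linarith
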